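/- Let $m>n$ be coprime positive integers and let $\mathbb H_{m/n}=\{(z_1,z_2)\in\mathbb C^2: |z_1|^{m/n}<|z_2|<1\}$. The Bergman kernel of $\mathbb H_{m/n}$, i.e. the reproducing kernel of the Hilbert space $A^2(\mathbb H_{m/n})$ of holomorphic functions on $\mathbb H_{m/n}$ that are square-integrable with respect to Lebesgue measure, exists and is given, for $z=(z_1,z_2)$ and $w=(w_1,w_2)$ in $\mathbb H_{m/n}$, $s=z_1\overline{w}_1$ and $t=z_2\overline{w}_2$, by $$K_{m/n}(z,w)=\frac{P_{m,n}(s,t)}{m\pi^2(1-t)^2(t^n-s^m)^2},$$ where the denominator does not vanish and $P_{m,n}=p_0+p_1+p_2+p_3+p_4$ with $$p_0(s,t)=m^2s^{m-1}t^n,$$ $$p_1(s,t)=\sum_{j=0}^{m-2}(j+1)(\kappa(j)+1)\,s^jt^{2n-L(j)},$$ $$p_2(s,t)=\sum_{j=0}^{m-2}(j+1)(m-\kappa(j)-1)\,s^jt^{2n+1-L(j)},$$ $$p_3(s,t)=\sum_{j=0}^{m-2}(m-j-1)(\kappa(j)+1)\,s^{j+m}t^{n-L(j)},$$ $$p_4(s,t)=\sum_{j=0}^{m-2}(m-j-1)(m-\kappa(j)-1)\,s^{j+m}t^{n+1-L(j)},$$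 $$L(j)=\left\lceil\frac{1+n(j+1)}{m}\right\rceil,\qquad \kappa(j)=m+n-1+nj-mL(j).$$ All the exponents are nonnegative, since $L(j)\le n$ for $0\le j\le m-2$. The polynomial $P_{m,n}$ has total degree $2m-1$ and exactly $4m-3$ monomials with nonzero coefficient. -/

import Mathlib

open MeasureTheory

noncomputable section

/-- The generalized Hartogs triangle `{(z₁, z₂) ∈ ℂ² : |z₁|^γ < |z₂| < 1}`. -/
def hartogsTriangle (γ : ℝ) : Set (ℂ × ℂ) :=
  {z | ‖z.1‖ ^ γ < ‖z.2‖ ∧ ‖z.2‖ < 1}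

/-- Membership in the Bergman space `A²(Ω)`: `f` is holomorphic on `Ω` and square-integrable
over `Ω` with respect to Lebesgue measure (values of `f` outside `Ω` play no role). -/
def MemBergmanSpace (Ω : Set (ℂ × ℂ)) (f : ℂ × ℂ → ℂ) : Prop :=
  DifferentiableOn ℂ f Ω ∧ MemLp f 2 (volume.restrict Ω)

/-- `K` is the Bergman kernel of `Ω`, i.e. the reproducing kernel of `A²(Ω)`: for every `w ∈ Ω`
the function `K(·, w)` belongs to `A²(Ω)`, and `f(z) = ⟨f, K(·, z)⟩` for all `f ∈ A²(Ω)` and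
`z ∈ Ω`. (Only values on `Ω × Ω` play a role; they are determined by these two properties, see
`IsBergmanKernel.unique`.) -/
structure IsBergmanKernel (Ω : Set (ℂ × ℂ)) (K : ℂ × ℂ → ℂ × ℂ → ℂ) : Prop where
  mem : ∀ w ∈ Ω, MemBergmanSpace Ω (fun z => K z w)
  reproducing : ∀ f : ℂ × ℂ → ℂ, MemBergmanSpace Ω f →
    ∀ z ∈ Ω, f z = ∫ w in Ω, f w * (starRingEnd ℂ) (K w z)

theorem IsBergmanKernel.eq_conj {Ω : Set (ℂ × ℂ)} {K K' : ℂ × ℂ → ℂ × ℂ → ℂ}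
    (h : IsBergmanKernel Ω K) (h' : IsBergmanKernel Ω K') {z w : ℂ × ℂ}
    (hz : z ∈ Ω) (hw : w ∈ Ω) : K z w = (starRingEnd ℂ) (K' w z) := by
  rw [h'.reproducing _ (h.mem w hw) z hz, h.reproducing _ (h'.mem z hz) w hw, ← integral_conj]
  simp [mul_comm]

/-- The Bergman kernel is unique. -/
theorem IsBergmanKernel.unique {Ω : Set (ℂ × ℂ)} {K K' : ℂ × ℂ → ℂ × ℂ → ℂ}
    (h : IsBergmanKernel Ω K) (h' : IsBergmanKernel Ω K') {z w : ℂ × ℂ}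
    (hz : z ∈ Ω) (hw : w ∈ Ω) : K z w = K' z w :=
  (h.eq_conj h' hz hw).trans (h'.eq_conj h' hz hw).symm

/-- With the reproducing property, `f(z) = ∫ K(z, w) f(w) dV(w)` for `f ∈ A²(Ω)`. -/
theorem IsBergmanKernel.integral_eq {Ω : Set (ℂ × ℂ)} (hΩ : MeasurableSet Ω)
    {K : ℂ × ℂ → ℂ × ℂ → ℂ} (h : IsBergmanKernel Ω K) {f : ℂ × ℂ → ℂ}
    (hf : MemBergmanSpace Ω f) {z : ℂ × ℂ} (hz : z ∈ Ω) :
    f z = ∫ w in Ω, K z w * f w := by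
  rw [h.reproducing f hf z hz]
  refine setIntegral_congr_fun hΩ fun w hw => ?_
  simp only [h.eq_conj h hz hw, mul_comm]

namespace HartogsKernel

/-- `L(j) = ⌈(1 + n (j + 1)) / m⌉`. -/
def L (m n j : ℕ) : ℤ := ⌈((1 + n * (j + 1) : ℚ) / m)⌉

/-- `κ(j) = m + n - 1 + n j - m L(j)`. -/
def kappa (m n j : ℕ) : ℤ := m + n - 1 + n * j - m * L m n j

/-- In the range of summation `j = 0, …, m - 2` one has `L(j) ≤ n`, so all the exponents of `t`
below are nonnegative integers and `Int.toNat` does not change them. -/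
theorem L_le {m n j : ℕ} (hn : 0 < n) (hj : j + 2 ≤ m) : L m n j ≤ n := by
  have hm : (0 : ℚ) < m := by exact_mod_cast (by omega : 0 < m)
  have h : 1 + n * (j + 1) ≤ n * m := by nlinarith
  unfold L
  rw [Int.ceil_le, div_le_iff₀ hm]
  exact_mod_cast h

open MvPolynomial

/-- The polynomials below have integer coefficients; `X 0` is `s` and `X 1` is `t`. -/
def p0 (m n : ℕ) : MvPolynomial (Fin 2) ℤ :=
  C ((m : ℤ) ^ 2) * X 0 ^ (m - 1) * X 1 ^ n

def p1 (m n : ℕ) : MvPolynomial (Fin 2) ℤ :=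
  ∑ j ∈ Finset.range (m - 1),
    C (((j : ℤ) + 1) * (kappa m n j + 1)) * X 0 ^ j * X 1 ^ (2 * (n : ℤ) - L m n j).toNat

def p2 (m n : ℕ) : MvPolynomial (Fin 2) ℤ :=
  ∑ j ∈ Finset.range (m - 1),
    C (((j : ℤ) + 1) * (m - kappa m n j - 1)) * X 0 ^ j *
      X 1 ^ (2 * (n : ℤ) + 1 - L m n j).toNat

def p3 (m n : ℕ) : MvPolynomial (Fin 2) ℤ :=
  ∑ j ∈ Finset.range (m - 1),
    C (((m : ℤ) - j - 1) * (kappa m n j + 1)) * X 0 ^ (j + m) * X 1 ^ ((n : ℤ) - L m n j).toNat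

def p4 (m n : ℕ) : MvPolynomial (Fin 2) ℤ :=
  ∑ j ∈ Finset.range (m - 1),
    C (((m : ℤ) - j - 1) * (m - kappa m n j - 1)) * X 0 ^ (j + m) *
      X 1 ^ ((n : ℤ) + 1 - L m n j).toNat

/-- The numerator polynomial `P_{m,n}(s, t)`. -/
def P (m n : ℕ) : MvPolynomial (Fin 2) ℤ :=
  p0 m n + p1 m n + p2 m n + p3 m n + p4 m n

end HartogsKernel

end

/-! For a ≥ 0 the monomial z₁^a z₂^b is square-integrable on the domain exactly when 1 + b +
n(a+1)/m > 0, and its squared norm is then π² / ((a+1)(1 + b + n(a+1)/m)). With b = k - `ell a` the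
last factor becomes k + `res a`/m, where `res a` lies in {1, …, m}; so the condition is k ≥ 0, and
the kernel should be (mπ²)⁻¹ Σ (a+1)(`res a` + mk) s^a t^(k - `ell a`). Passing from a to a + m adds
n to `ell` and fixes `res`. Hence on each residue class a = j + mq the double series is a product of
two series of the form Σ (α + βq) u^q, with ratios s^m/t^n and t (`hasSum_kerTerm`). Adding the m
closed forms gives the quotient, and coprimality identifies its numerator with P (`aeval_P`).

The reproducing property is checked directly, without an orthonormal basis or completeness. Expand f
in powers of z₁ on the slices, which are discs centred at 0. The coefficients c_a(z₂) are
holomorphic on the punctured disc, and square-integrability forces z₂^`ell a` c_a to extend across 0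
(`norm_taylorCoeff_mul_le`, `exists_differentiableOn_pow_mul_taylorCoeff`). Fubini and polar
coordinates then turn the inner product of f with a monomial into a Laurent coefficient
(`setIntegral_mul_conj_monomial`). A single L² function dominates all the monomials, so the kernel
can be integrated term by term (`hasSum_integral_kerPart`); the weights cancel the norms, leaving Σ
c_a z₁^a = f.

The monomial count and the degree are read off from P written as a sum of monomials with distinct
exponents and nonzero coefficients. -/

noncomputable section

/-! ### Arithmetic of the exponents and the numerator polynomial -/

namespace HartogsKernel

/-- The least `l` with `n (a + 1) ≤ m l`. -/
def ell (m n a : ℕ) : ℕ := (n * (a + 1) + (m - 1)) / m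

/-- The number in `{1, …, m}` congruent to `n (a + 1)` modulo `m`. -/
def res (m n a : ℕ) : ℕ := (n * (a + 1) + (m - 1)) % m + 1

/-- Euclidean division with remainders in {1, …, m} instead of {0, …, m - 1}: the range for which k
+ `res`/m > 0 is equivalent to k ≥ 0 for integers k. -/
theorem mul_ell_add_res {m : ℕ} (hm : 0 < m) (n a : ℕ) :
    m * ell m n a + res m n a = n * (a + 1) + m := by
  have := Nat.div_add_mod (n * (a + 1) + (m - 1)) m
  unfold ell res
  omega

theorem res_pos (m n a : ℕ) : 0 < res m n a := Nat.succ_pos _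

theorem res_le {m : ℕ} (hm : 0 < m) (n a : ℕ) : res m n a ≤ m := Nat.mod_lt _ hm

/-- Together with `res_add_mul`, this periodicity is what makes the kernel series factor on each
residue class. -/
theorem ell_add_mul {m : ℕ} (hm : 0 < m) (n j q : ℕ) :
    ell m n (j + m * q) = ell m n j + n * q := by
  unfold ell
  rw [← Nat.add_mul_div_left _ _ hm]
  congr 1
  ring

theorem res_add_mul (m n j q : ℕ) : res m n (j + m * q) = res m n j := by
  unfold res
  rw [← Nat.add_mul_mod_self_left (n * (j + 1) + (m - 1)) m (n * q)]
  congr 2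
  ring

theorem ell_le {m n j : ℕ} (hj : j < m) : ell m n j ≤ n := by
  unfold ell
  rw [← Nat.lt_succ_iff, Nat.div_lt_iff_lt_mul (by omega)]
  have : n * (j + 1) ≤ n * m := Nat.mul_le_mul_left _ hj
  have h2 : n.succ * m = n * m + m := Nat.succ_mul _ _
  omega

/-- Equality would give m ∣ n(j+1), hence m ∣ j+1 by coprimality, which is impossible for 0 < j+1 <
m. -/
theorem res_lt {m n j : ℕ} (hcop : Nat.Coprime m n) (hj : j + 2 ≤ m) : res m n j < m := by
  have hm : 0 < m := by omega
  refine lt_of_le_of_ne (res_le hm n j) fun h => ?_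
  have h1 := mul_ell_add_res hm n j
  have h2 : m ∣ n * (j + 1) := ⟨ell m n j, by omega⟩
  have := Nat.le_of_dvd (by omega) (hcop.dvd_of_dvd_mul_left h2)
  omega

/-- `L` is the least l with n(j+1) < ml, `ell` the least with n(j+1) ≤ ml; they agree because m does
not divide n(j+1) in this range. -/
theorem L_eq {m n j : ℕ} (hcop : Nat.Coprime m n) (hj : j + 2 ≤ m) :
    L m n j = ell m n j := by
  have hm : 0 < m := by omega
  have h1 := mul_ell_add_res hm n j
  have h2 := res_lt hcop hj
  have h3 := res_pos m n j
  have hm' : (0 : ℚ) < m := by exact_mod_cast hm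
  unfold L
  rw [Int.ceil_eq_iff, lt_div_iff₀ hm', div_le_iff₀ hm']
  constructor
  · have : m * ell m n j < 1 + n * (j + 1) + m := by omega
    have : (m * ell m n j : ℚ) < 1 + n * (j + 1) + m := by exact_mod_cast this
    push_cast
    linarith
  · have : 1 + n * (j + 1) ≤ ell m n j * m := by rw [mul_comm (ell m n j)]; omega
    exact_mod_cast this

theorem kappa_eq {m n j : ℕ} (hcop : Nat.Coprime m n) (hj : j + 2 ≤ m) :
    kappa m n j = res m n j - 1 := by
  have h1 : (m * ell m n j + res m n j : ℤ) = n * (j + 1) + m := by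
    exact_mod_cast mul_ell_add_res (by omega : 0 < m) n j
  unfold kappa
  rw [L_eq hcop hj]
  linarith

open MvPolynomial

theorem support_sum_monomial {σ R ι : Type*} [DecidableEq σ] [CommSemiring R] [Fintype ι]
    (e : ι → σ →₀ ℕ) (c : ι → R) (he : Function.Injective e) (hc : ∀ i, c i ≠ 0) :
    (∑ i, monomial (e i) (c i)).support = Finset.univ.image e := by
  classical
  ext d
  simp only [mem_support_iff, coeff_sum, coeff_monomial, Finset.mem_image, Finset.mem_univ,
    true_and]
  constructor
  · intro h
    obtain ⟨i, -, hi⟩ := Finset.exists_ne_zero_of_sum_ne_zero h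
    exact ⟨i, by by_contra h'; simp [h'] at hi⟩
  · rintro ⟨i, rfl⟩
    simp [he.eq_iff, hc i]

/-- Exponents of the monomials of `P`. -/
def expo (m n : ℕ) : Option (Fin (m - 1) × Bool × Bool) → ℕ × ℕ
  | none => (m - 1, n)
  | some (j, false, false) => (j, 2 * n - ell m n j)
  | some (j, false, true) => (j, 2 * n + 1 - ell m n j)
  | some (j, true, false) => (j + m, n - ell m n j)
  | some (j, true, true) => (j + m, n + 1 - ell m n j)

/-- Coefficients of the monomials of `P`. -/
def coef (m n : ℕ) : Option (Fin (m - 1) × Bool × Bool) → ℤ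
  | none => (m : ℤ) ^ 2
  | some (j, false, false) => (j + 1) * res m n j
  | some (j, false, true) => (j + 1) * (m - res m n j)
  | some (j, true, false) => (m - j - 1) * res m n j
  | some (j, true, true) => (m - j - 1) * (m - res m n j)

/-- The exponent vector of `X 0 ^ x * X 1 ^ y`. -/
def expVec (p : ℕ × ℕ) : Fin 2 →₀ ℕ := Finsupp.single 0 p.1 + Finsupp.single 1 p.2

theorem expVec_injective : Function.Injective expVec := by
  rintro ⟨a, b⟩ ⟨c, d⟩ h
  have h0 := DFunLike.congr_fun h 0
  have h1 := DFunLike.congr_fun h 1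
  simp [expVec] at h0 h1
  simp [h0, h1]

theorem C_mul_X_pow_mul_X_pow (c : ℤ) (x y : ℕ) :
    (C c * X 0 ^ x * X 1 ^ y : MvPolynomial (Fin 2) ℤ) = monomial (expVec (x, y)) c := by
  rw [X_pow_eq_monomial, X_pow_eq_monomial, C_mul_monomial, monomial_mul]
  simp [expVec]

/-- The powers of s fall into the disjoint ranges j ≤ m - 2, m - 1 and j + m ≥ m, which determine j
and the first Boolean. The second Boolean raises the power of t by one; `ell_le` ensures that
truncated subtraction does not hide this. -/
theorem expo_injective {m n : ℕ} : Function.Injective (expo m n) := by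
  rintro (_ | ⟨j, p, q⟩) (_ | ⟨j', p', q'⟩) h
  · rfl
  · exfalso
    have := j'.2
    rcases p' <;> rcases q' <;> simp only [expo, Prod.mk.injEq] at h <;> omega
  · exfalso
    have := j.2
    rcases p <;> rcases q <;> simp only [expo, Prod.mk.injEq] at h <;> omega
  · have hj := j.2
    have hj' := j'.2
    have h1 : (j : ℕ) = j' := by
      rcases p <;> rcases q <;> rcases p' <;> rcases q' <;>
        simp only [expo, Prod.mk.injEq] at h <;> omega
    have h1 : j = j' := Fin.ext h1
    subst h1
    have := ell_le (n := n) (show (j : ℕ) < m by omega)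
    rcases p <;> rcases q <;> rcases p' <;> rcases q' <;>
        simp only [expo, Prod.mk.injEq] at h <;> first | rfl | omega

theorem coef_ne_zero {m n : ℕ} (hm : 0 < m) (hcop : Nat.Coprime m n)
    (i : Option (Fin (m - 1) × Bool × Bool)) : coef m n i ≠ 0 := by
  rcases i with _ | ⟨j, p, q⟩
  · simp only [coef]; positivity
  · have hj := j.2
    have h1 := res_lt hcop (show (j : ℕ) + 2 ≤ m by omega)
    have h2 := res_pos m n j
    rcases p <;> rcases q <;> simp only [coef] <;> refine mul_ne_zero ?_ ?_ <;> omega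

theorem P_eq_sum_monomial {m n : ℕ} (hcop : Nat.Coprime m n) :
    P m n = ∑ i, monomial (expVec (expo m n i)) (coef m n i) := by
  have key : ∀ j ∈ Finset.range (m - 1), (2 * (n : ℤ) - L m n j).toNat = 2 * n - ell m n j ∧
      (2 * (n : ℤ) + 1 - L m n j).toNat = 2 * n + 1 - ell m n j ∧
      ((n : ℤ) - L m n j).toNat = n - ell m n j ∧
      ((n : ℤ) + 1 - L m n j).toNat = n + 1 - ell m n j ∧
      kappa m n j = res m n j - 1 := by
    intro j hj
    rw [Finset.mem_range] at hj
    rw [L_eq hcop (by omega)]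
    exact ⟨by omega, by omega, by omega, by omega, kappa_eq hcop (by omega)⟩
  simp only [Fintype.sum_option, Fintype.sum_prod_type, Fintype.sum_bool, expo, coef,
    ← C_mul_X_pow_mul_X_pow]
  unfold P p0 p1 p2 p3 p4
  rw [add_assoc, add_assoc, add_assoc, ← Finset.sum_add_distrib, ← Finset.sum_add_distrib,
    ← Finset.sum_add_distrib, Finset.sum_range]
  congr 1
  refine Finset.sum_congr rfl fun j _ => ?_
  obtain ⟨h1, h2, h3, h4, h5⟩ := key j (Finset.mem_range.2 j.2)
  rw [h1, h2, h3, h4, h5]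
  have e1 : (res m n j : ℤ) - 1 + 1 = res m n j := by ring
  have e2 : (m : ℤ) - (res m n j - 1) - 1 = m - res m n j := by ring
  rw [e1, e2]
  ring

theorem card_support_P {m n : ℕ} (hm : 0 < m) (hcop : Nat.Coprime m n) :
    (P m n).support.card = 4 * m - 3 := by
  rw [P_eq_sum_monomial hcop, support_sum_monomial (fun i => expVec (expo m n i)) _
    (expVec_injective.comp expo_injective) (coef_ne_zero hm hcop),
    Finset.card_image_of_injective (f := fun i => expVec (expo m n i)) _
    (expVec_injective.comp expo_injective)]
  simp
  omega

theorem expo_add_le {m n : ℕ} (hmn : n < m) (i : Option (Fin (m - 1) × Bool × Bool)) :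
    (expo m n i).1 + (expo m n i).2 ≤ 2 * m - 1 := by
  rcases i with _ | ⟨j, p, q⟩
  · simp only [expo]; omega
  · have hj := j.2
    have h1 := mul_ell_add_res (show 0 < m by omega) n j
    have h2 := res_le (show 0 < m by omega) n j
    -- The negation, multiplied by m, would give (m - n)(m - j - 1) ≤ 0.
    have h3 : (j : ℕ) + 2 + n ≤ m + ell m n j := by
      by_contra! h
      have : m * (j + 2 + n) ≥ m * (m + ell m n j + 1) := Nat.mul_le_mul_left _ h
      have hmj : ((j : ℕ) : ℤ) + 1 < m := by omega
      have hnm : (n : ℤ) < m := by omega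
      zify at this h1 h2
      nlinarith
    have h4 := ell_le (n := n) (show (j : ℕ) < m by omega)
    rcases p <;> rcases q <;> simp only [expo] <;> omega

theorem totalDegree_P {m n : ℕ} (hn : 0 < n) (hmn : n < m) (hcop : Nat.Coprime m n) :
    (P m n).totalDegree = 2 * m - 1 := by
  have hdeg : ∀ p, ((expVec p).sum fun _ e => e) = p.1 + p.2 := fun p => by
    rw [Finsupp.sum_fintype _ _ (fun _ => rfl)]
    simp [expVec]
  rw [totalDegree, P_eq_sum_monomial hcop,
    support_sum_monomial (fun i => expVec (expo m n i)) _ (expVec_injective.comp expo_injective)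
    (coef_ne_zero (by omega) hcop), Finset.sup_image]
  refine le_antisymm (Finset.sup_le fun i _ => ?_) ?_
  · simp only [Function.comp_apply, hdeg]
    exact expo_add_le hmn i
  -- The last term of `p4`, at j = m - 2, attains the degree: 2m - 2 + n + 1 - `ell` is at least 2m
  -- - 1.
  · refine le_trans ?_ (Finset.le_sup (Finset.mem_univ (some (⟨m - 2, by omega⟩, true, true))))
    simp only [Function.comp_apply, hdeg, expo]
    have h1 := ell_le (n := n) (show m - 2 < m by omega)
    omega

/-- A form of the numerator in which the residues modulo `m` are treated alike. -/
theorem aeval_P {m n : ℕ} (hm : 0 < m) (hcop : Nat.Coprime m n) (s t : ℂ) :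
    aeval ![s, t] (P m n) = ∑ j ∈ Finset.range m, s ^ j * t ^ (n - ell m n j) *
      ((res m n j : ℂ) + (m - res m n j) * t) * ((j + 1) * t ^ n + (m - j - 1) * s ^ m) := by
  -- For j = m - 1 both m - `res` and m - j - 1 vanish, so the uniform summand collapses to `p0`.
  have hlast : ell m n (m - 1) = n ∧ res m n (m - 1) = m := by
    have h1 := mul_ell_add_res hm n (m - 1)
    rw [Nat.sub_add_cancel hm] at h1
    have h2 := res_le hm n (m - 1)
    have h3 := res_pos m n (m - 1)
    have h4 := ell_le (n := n) (show m - 1 < m by omega)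
    have h5 : n ≤ ell m n (m - 1) := by
      by_contra! h
      have : m * (ell m n (m - 1) + 1) ≤ m * n := Nat.mul_le_mul_left _ h
      have h' : m * n = n * m := mul_comm _ _
      rw [mul_add] at this
      omega
    have h6 : ell m n (m - 1) = n := le_antisymm h4 h5
    rw [h6, mul_comm m n] at h1
    omega
  obtain ⟨k, rfl⟩ : ∃ k, m = k + 1 := ⟨m - 1, by omega⟩
  rw [P_eq_sum_monomial hcop, Finset.sum_range_succ]
  simp only [Fintype.sum_option, Fintype.sum_prod_type, Fintype.sum_bool, expo, coef,
    ← C_mul_X_pow_mul_X_pow, Nat.add_sub_cancel] at hlast ⊢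
  simp only [map_add, map_sum, map_mul, map_pow, aeval_X, aeval_C, Matrix.cons_val_zero,
    Matrix.cons_val_one]
  rw [Finset.sum_range, hlast.1, hlast.2, add_comm]
  congr 1
  · refine Finset.sum_congr rfl fun j _ => ?_
    obtain ⟨d, hd⟩ := Nat.exists_eq_add_of_le
      (ell_le (m := k + 1) (n := n) (show (j : ℕ) < k + 1 by omega))
    have e1 : 2 * n - ell (k + 1) n j = n + d := by omega
    have e2 : 2 * n + 1 - ell (k + 1) n j = n + d + 1 := by omega
    have e3 : n - ell (k + 1) n j = d := by omega
    have e4 : n + 1 - ell (k + 1) n j = d + 1 := by omega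
    rw [e1, e2, e3, e4]
    simp
    ring
  · simp
    ring

end HartogsKernel

/-! ### Summation of the kernel series -/

namespace HartogsKernel

theorem hasSum_linear_mul_geometric (α β : ℂ) {u : ℂ} (hu : ‖u‖ < 1) :
    HasSum (fun q : ℕ => (α + β * q) * u ^ q) ((α + (β - α) * u) / (1 - u) ^ 2) := by
  have hu1 : 1 - u ≠ 0 := by
    intro h
    rw [sub_eq_zero] at h
    rw [← h] at hu
    simp at hu
  have h := ((hasSum_geometric_of_norm_lt_one hu).mul_left α).add
    ((hasSum_coe_mul_geometric_of_norm_lt_one hu).mul_left β)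
  convert! h using 1
  · ext q; ring
  · field_simp
    ring

theorem hasSum_mul_mul {f g : ℕ → ℂ} {x y : ℂ} (hf : HasSum f x) (hg : HasSum g y) (c : ℂ) :
    HasSum (fun p : ℕ × ℕ => c * (f p.1 * g p.2)) (c * (x * y)) :=
  (hf.mul hg (summable_mul_of_summable_norm hf.summable.norm hg.summable.norm)).mul_left c

/-- The terms of the expansion of the kernel, up to the factor `m π²`. -/
def kerTerm (m n : ℕ) (s t : ℂ) (a k : ℕ) : ℂ :=
  ((a + 1) * (res m n a + m * k)) * (s ^ a * t ^ ((k : ℤ) - ell m n a))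

/-- Clearing denominators in the series of ratio s^m/t^n leaves one surplus factor t^n, which
combines with t^(-`ell`) to the nonnegative power t^(n - `ell`). -/
theorem kerSum_eq {m n : ℕ} {s t : ℂ} (ht : t ≠ 0) (ht1 : ‖t‖ < 1)
    (hst : ‖s‖ ^ m < ‖t‖ ^ n) {j : ℕ} (hj : j < m) :
    s ^ j * t ^ (n - ell m n j) * ((res m n j : ℂ) + (m - res m n j) * t) *
        ((j + 1) * t ^ n + (m - j - 1) * s ^ m) / ((1 - t) ^ 2 * (t ^ n - s ^ m) ^ 2) =
      s ^ j * t ^ (-(ell m n j : ℤ)) * (((j + 1 : ℂ) + (m - (j + 1)) * (s ^ m / t ^ n)) /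
        (1 - s ^ m / t ^ n) ^ 2 * ((res m n j + (m - res m n j) * t) / (1 - t) ^ 2)) := by
  have htn : t ^ n ≠ 0 := pow_ne_zero _ ht
  have hst' : t ^ n - s ^ m ≠ 0 := by
    intro h
    rw [sub_eq_zero] at h
    rw [← norm_pow, ← norm_pow, h] at hst
    exact lt_irrefl _ hst
  have ht' : 1 - t ≠ 0 := by
    intro h
    rw [sub_eq_zero] at h
    rw [← h] at ht1
    simp at ht1
  have e : t ^ (n - ell m n j) = t ^ n * t ^ (-(ell m n j : ℤ)) := by
    rw [zpow_neg, zpow_natCast, ← div_eq_mul_inv, eq_div_iff (pow_ne_zero _ ht), ← pow_add,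
      Nat.sub_add_cancel (ell_le hj)]
  rw [e]
  generalize t ^ (-(ell m n j : ℤ)) = E
  generalize t ^ n = T at htn hst' ⊢
  generalize s ^ m = V at hst' ⊢
  rw [show 1 - V / T = (T - V) / T by field_simp]
  field_simp
  ring

/-- The sum of the terms with index in a given residue class modulo `m`. -/
theorem hasSum_kerTerm {m n : ℕ} (hm : 0 < m) {s t : ℂ} (ht : t ≠ 0) (ht1 : ‖t‖ < 1)
    (hst : ‖s‖ ^ m < ‖t‖ ^ n) {j : ℕ} (hj : j < m) :
    HasSum (fun p : ℕ × ℕ => kerTerm m n s t (j + m * p.1) p.2)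
      (s ^ j * t ^ (n - ell m n j) * ((res m n j : ℂ) + (m - res m n j) * t) *
        ((j + 1) * t ^ n + (m - j - 1) * s ^ m) / ((1 - t) ^ 2 * (t ^ n - s ^ m) ^ 2)) := by
  have htn : t ^ n ≠ 0 := pow_ne_zero _ ht
  have hu : ‖s ^ m / t ^ n‖ < 1 := by
    rw [norm_div, norm_pow, norm_pow, div_lt_one (by positivity)]
    exact hst
  have h1 := hasSum_linear_mul_geometric (j + 1) m hu
  have h2 := hasSum_linear_mul_geometric (res m n j) m ht1
  have h := hasSum_mul_mul h1 h2 (s ^ j * t ^ (-(ell m n j : ℤ)))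
  rw [kerSum_eq ht ht1 hst hj]
  refine (congrArg (fun f => HasSum f _) (funext ?_)).mpr h
  intro p
  unfold kerTerm
  rw [res_add_mul, ell_add_mul hm]
  have e : ((p.2 : ℤ) - ((ell m n j + n * p.1 : ℕ) : ℤ)) =
    -(ell m n j : ℤ) + (p.2 : ℤ) - ((n * p.1 : ℕ) : ℤ) := by push_cast; ring
  rw [e, zpow_sub₀ ht, zpow_add₀ ht, zpow_natCast, zpow_natCast, div_pow, ← pow_mul, ← pow_mul,
    pow_add]
  push_cast
  rw [div_eq_mul_inv, div_eq_mul_inv]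
  ring

theorem aeval_P_div {m n : ℕ} (hm : 0 < m) (hcop : Nat.Coprime m n) (s t : ℂ) :
    MvPolynomial.aeval ![s, t] (P m n) /
      (m * (Real.pi : ℂ) ^ 2 * (1 - t) ^ 2 * (t ^ n - s ^ m) ^ 2) =
    (m * (Real.pi : ℂ) ^ 2)⁻¹ * ∑ j ∈ Finset.range m,
      s ^ j * t ^ (n - ell m n j) * ((res m n j : ℂ) + (m - res m n j) * t) *
        ((j + 1) * t ^ n + (m - j - 1) * s ^ m) / ((1 - t) ^ 2 * (t ^ n - s ^ m) ^ 2) := by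
  rw [aeval_P hm hcop, ← Finset.sum_div, mul_assoc (_ * _), div_eq_mul_inv, div_eq_mul_inv,
    mul_inv (_ * _)]
  ring

end HartogsKernel

/-! ### Moments over circles and discs -/

open ComplexConjugate in
theorem integral_circleMap_pow_mul_conj_pow (r : ℝ) (l k : ℕ) :
    ∫ θ in (-Real.pi)..Real.pi, circleMap 0 r θ ^ l * conj (circleMap 0 r θ) ^ k =
      if l = k then (2 * Real.pi * r ^ (2 * k) : ℂ) else 0 := by
  have h : ∀ θ : ℝ, circleMap 0 r θ ^ l * conj (circleMap 0 r θ) ^ k =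
      r ^ (l + k) * Complex.exp ((((l : ℤ) - k : ℤ) * Complex.I) * θ) := fun θ => by
    simp only [circleMap, zero_add, map_mul, Complex.conj_ofReal, ← Complex.exp_conj,
      Complex.conj_I, mul_pow, ← Complex.exp_nat_mul]
    rw [show (r : ℂ) ^ l * Complex.exp (l * (θ * Complex.I)) * (r ^ k * Complex.exp
      (k * (θ * -Complex.I))) = r ^ (l + k) * (Complex.exp (l * (θ * Complex.I)) * Complex.exp
      (k * (θ * -Complex.I))) by ring, ← Complex.exp_add]
    congr 2
    push_cast
    ring
  simp_rw [h]
  rw [intervalIntegral.integral_const_mul]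
  split_ifs with hlk
  · subst hlk
    simp
    ring
  · have hc : (((l : ℤ) - k : ℤ) * Complex.I : ℂ) ≠ 0 :=
      mul_ne_zero (Int.cast_ne_zero.2 (by omega)) Complex.I_ne_zero
    rw [integral_exp_mul_complex hc]
    -- The antiderivative is 2π-periodic, so its values at the two endpoints cancel.
    have : Complex.exp ((((l : ℤ) - k : ℤ) * Complex.I : ℂ) * (Real.pi : ℝ)) =
        Complex.exp ((((l : ℤ) - k : ℤ) * Complex.I : ℂ) * ((-Real.pi : ℝ) : ℂ)) := by
      rw [Complex.exp_eq_exp_iff_exists_int]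
      exact ⟨(l : ℤ) - k, by push_cast; ring⟩
    rw [this]
    simp

open ComplexConjugate in
theorem integral_mul_conj_circleMap_pow {G : ℂ → ℂ} {c : ℕ → ℂ} {r : ℝ}
    (h : ∀ θ : ℝ, HasSum (fun l => c l * circleMap 0 r θ ^ l) (G (circleMap 0 r θ))) (k : ℕ) :
    ∫ θ in (-Real.pi)..Real.pi, G (circleMap 0 r θ) * conj (circleMap 0 r θ) ^ k =
      2 * Real.pi * c k * r ^ (2 * k) := by
  -- The norms of the terms do not depend on θ, so convergence at θ = 0 alone provides the
  -- dominating series.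
  have hs : Summable fun l => ‖c l‖ * |r| ^ l := by
    simpa using (h 0).summable.norm
  have h1 := intervalIntegral.hasSum_integral_of_dominated_convergence (μ := volume)
    (a := -Real.pi) (b := Real.pi)
    (F := fun (l : ℕ) θ => c l * (circleMap 0 r θ ^ l * conj (circleMap 0 r θ) ^ k))
    (f := fun θ => G (circleMap 0 r θ) * conj (circleMap 0 r θ) ^ k)
    (fun l _ => ‖c l‖ * |r| ^ l * |r| ^ k)
    (fun l => Continuous.aestronglyMeasurable (by fun_prop))
    (fun l => Filter.Eventually.of_forall fun θ _ => le_of_eq (by simp [mul_assoc]))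
    (Filter.Eventually.of_forall fun θ _ => hs.mul_right _)
    intervalIntegrable_const
    (Filter.Eventually.of_forall fun θ _ => by
      simpa only [mul_assoc] using (h θ).mul_right (conj (circleMap 0 r θ) ^ k))
  have h2 : HasSum (fun l => ∫ θ in (-Real.pi)..Real.pi,
      c l * (circleMap 0 r θ ^ l * conj (circleMap 0 r θ) ^ k))
      (2 * Real.pi * c k * r ^ (2 * k)) := by
    convert! hasSum_ite_eq k (2 * Real.pi * c k * r ^ (2 * k) : ℂ) using 2 with l
    rw [intervalIntegral.integral_const_mul, integral_circleMap_pow_mul_conj_pow]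
    split_ifs with hl
    · subst hl; ring
    · simp
  exact h1.unique h2

/-- Polar coordinates contribute a factor r, so the threshold is μ + 1 > -1. -/
theorem integrableOn_ball_norm_rpow (R : ℝ) {μ : ℝ} (hμ : -2 < μ) :
    IntegrableOn (fun w : ℂ => ‖w‖ ^ μ) (Metric.ball 0 R) := by
  rcases le_or_gt R 0 with hR | hR
  · rw [Metric.ball_eq_empty.2 hR]
    exact integrableOn_empty
  rw [← integrable_indicator_iff Metric.isOpen_ball.measurableSet]
  have e : (Metric.ball (0 : ℂ) R).indicator (fun w : ℂ => ‖w‖ ^ μ) =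
      fun w => (Set.Iio R).indicator (fun r : ℝ => r ^ μ) ‖w‖ := by
    ext w
    by_cases hw : ‖w‖ < R <;> simp [Set.indicator, hw]
  rw [e, integrable_fun_norm_addHaar, Complex.finrank_real_complex]
  have h1 : IntegrableOn (fun r : ℝ => r ^ (μ + 1)) (Set.Ioo 0 R) := by
    have := intervalIntegral.intervalIntegrable_rpow' (a := 0) (b := R) (r := μ + 1) (by linarith)
    rw [intervalIntegrable_iff_integrableOn_Ioo_of_le hR.le] at this
    exact this
  have e2 : Set.EqOn (fun r : ℝ => r ^ (2 - 1) • (Set.Iio R).indicator (fun r : ℝ => r ^ μ) r)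
      ((Set.Iio R).indicator (fun r : ℝ => r ^ (μ + 1))) (Set.Ioi 0) := by
    intro r hr
    simp only [Set.indicator_apply]
    split_ifs
    · simp [Real.rpow_add_one (ne_of_gt hr), mul_comm]
    · simp
  rw [integrableOn_congr_fun e2 measurableSet_Ioi, IntegrableOn, integrable_indicator_iff
    measurableSet_Iio, IntegrableOn, Measure.restrict_restrict measurableSet_Iio]
  rwa [Set.inter_comm, Set.Ioi_inter_Iio]

open ComplexConjugate in
/-- Moments of a holomorphic function over a disc, with a radial power weight. -/
theorem setIntegral_ball_mul_conj_pow {G : ℂ → ℂ} {c : ℕ → ℂ} {R : ℝ} (hR : 0 < R)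
    (hG : ContinuousOn G (Metric.ball 0 R))
    (h : ∀ w ∈ Metric.ball (0 : ℂ) R, HasSum (fun l => c l * w ^ l) (G w)) (k : ℕ) {μ : ℝ}
    (hμ : 0 < 2 * k + 2 + μ)
    (hint : IntegrableOn (fun w => G w * conj w ^ k * (‖w‖ ^ μ : ℝ)) (Metric.ball 0 R)) :
    ∫ w in Metric.ball 0 R, G w * conj w ^ k * (‖w‖ ^ μ : ℝ) =
      c k * (2 * Real.pi * R ^ (2 * k + 2 + μ) / (2 * k + 2 + μ) : ℝ) := by
  set F : ℂ → ℂ := fun w => G w * conj w ^ k * (‖w‖ ^ μ : ℝ) with hF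
  set S : Set (ℝ × ℝ) := Set.Ioo 0 R ×ˢ Set.Ioo (-Real.pi) Real.pi with hS
  have hSm : MeasurableSet S := measurableSet_Ioo.prod measurableSet_Ioo
  have hsub : S ⊆ polarCoord.target := Set.prod_mono Set.Ioo_subset_Ioi_self subset_rfl
  have hTm : MeasurableSet polarCoord.target := polarCoord.open_target.measurableSet
  have hpc : ∀ p : ℝ × ℝ, Complex.polarCoord.symm p = circleMap 0 p.1 p.2 := fun p => by
    rw [Complex.polarCoord_symm_apply, circleMap, zero_add, Complex.exp_mul_I]
    push_cast
    ring
  have hind : ∀ {E : Type} [NormedAddCommGroup E] (Φ : ℂ → E), ∀ p ∈ polarCoord.target,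
      (Metric.ball (0 : ℂ) R).indicator Φ (Complex.polarCoord.symm p) =
        S.indicator (fun p => Φ (circleMap 0 p.1 p.2)) p := by
    intro E _ Φ p hp
    have hp' : 0 < p.1 ∧ -Real.pi < p.2 ∧ p.2 < Real.pi := hp
    have hiff : circleMap 0 p.1 p.2 ∈ Metric.ball (0 : ℂ) R ↔ p ∈ S := by
      simp [hS, Set.mem_prod, hp'.1, hp'.2.1, hp'.2.2, abs_of_pos hp'.1]
    rw [hpc]
    by_cases hpS : p ∈ S
    · rw [Set.indicator_of_mem hpS, Set.indicator_of_mem (hiff.2 hpS)]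
    · rw [Set.indicator_of_notMem hpS, Set.indicator_of_notMem (fun h => hpS (hiff.1 h))]
  have hcont : ContinuousOn (fun p : ℝ × ℝ => p.1 • F (circleMap 0 p.1 p.2)) S := by
    have hcm : Continuous fun p : ℝ × ℝ => circleMap 0 p.1 p.2 := by
      unfold circleMap; fun_prop
    have hmaps : Set.MapsTo (fun p : ℝ × ℝ => circleMap 0 p.1 p.2) S (Metric.ball 0 R) := by
      intro p hp
      have hp' : (0 < p.1 ∧ p.1 < R) ∧ -Real.pi < p.2 ∧ p.2 < Real.pi := hp
      simp [abs_of_pos hp'.1.1, hp'.1.2]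
    have hG' := hG.comp hcm.continuousOn hmaps
    refine continuousOn_fst.smul ((hG'.mul (by fun_prop)).mul ?_)
    refine Complex.continuous_ofReal.comp_continuousOn ?_
    refine ContinuousOn.rpow_const (by fun_prop) fun p hp => Or.inl ?_
    have hp' : (0 < p.1 ∧ p.1 < R) ∧ -Real.pi < p.2 ∧ p.2 < Real.pi := hp
    simp [hp'.1.1.ne']
  -- Fubini needs absolute integrability in polar coordinates. It has to be carried over from
  -- `hint`, since μ may be negative and G may be unbounded near the boundary circle.
  have hint' : IntegrableOn (fun p : ℝ × ℝ => p.1 • F (circleMap 0 p.1 p.2)) S := by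
    refine ⟨hcont.aestronglyMeasurable hSm, ?_⟩
    have h1 : ∫⁻ w, (Metric.ball (0 : ℂ) R).indicator (fun w => ‖F w‖ₑ) w < ⊤ := by
      rw [lintegral_indicator Metric.isOpen_ball.measurableSet]
      exact hint.2
    rw [← Complex.lintegral_comp_polarCoord_symm] at h1
    refine lt_of_le_of_lt ?_ h1
    rw [← lintegral_indicator hSm, ← lintegral_indicator hTm]
    refine lintegral_mono fun p => ?_
    by_cases hp : p ∈ S
    · have hp0 : 0 < p.1 := (hsub hp).1
      rw [Set.indicator_of_mem hp, Set.indicator_of_mem (hsub hp), hpc]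
      have : circleMap 0 p.1 p.2 ∈ Metric.ball (0 : ℂ) R := by
        have hp' : (0 < p.1 ∧ p.1 < R) ∧ -Real.pi < p.2 ∧ p.2 < Real.pi := hp
        simp [abs_of_pos hp'.1.1, hp'.1.2]
      rw [Set.indicator_of_mem this, enorm_smul, smul_eq_mul, Real.enorm_of_nonneg hp0.le]
    · rw [Set.indicator_of_notMem hp]
      exact zero_le
  have hstep : ∫ w in Metric.ball 0 R, F w =
      ∫ p in S, p.1 • F (circleMap 0 p.1 p.2) := by
    rw [← integral_indicator Metric.isOpen_ball.measurableSet,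
      ← Complex.integral_comp_polarCoord_symm, ← integral_indicator hTm, ← integral_indicator hSm]
    congr 1
    ext p
    by_cases hp : p ∈ polarCoord.target
    · rw [Set.indicator_of_mem hp, hind F p hp]
      by_cases hpS : p ∈ S
      · rw [Set.indicator_of_mem hpS, Set.indicator_of_mem hpS]
      · rw [Set.indicator_of_notMem hpS, Set.indicator_of_notMem hpS, smul_zero]
    · rw [Set.indicator_of_notMem hp, Set.indicator_of_notMem fun h => hp (hsub h)]
  rw [hstep, hS, Measure.volume_eq_prod, setIntegral_prod _ (by rwa [← Measure.volume_eq_prod])]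
  -- On each circle orthogonality retains only the coefficient of index k.
  have hinner : ∀ r ∈ Set.Ioo 0 R, ∫ θ in Set.Ioo (-Real.pi) Real.pi,
      r • F (circleMap 0 r θ) = c k * ((2 * Real.pi * r ^ (2 * k + 1 + μ) : ℝ) : ℂ) := by
    intro r hr
    have h1 := integral_mul_conj_circleMap_pow (G := G) (c := c) (r := r)
      (fun θ => h _ (by simp [abs_of_pos hr.1, hr.2])) k
    rw [intervalIntegral.integral_of_le (by linarith [Real.pi_pos]),
      integral_Ioc_eq_integral_Ioo] at h1
    have h2 : ∀ θ, r • F (circleMap 0 r θ) =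
        G (circleMap 0 r θ) * conj (circleMap 0 r θ) ^ k * (r * (r ^ μ : ℝ) : ℂ) := by
      intro θ
      simp only [hF, Complex.real_smul, norm_circleMap_zero, abs_of_pos hr.1]
      ring
    simp_rw [h2]
    rw [integral_mul_const, h1]
    have e : r ^ (2 * (k : ℝ) + 1 + μ) = r ^ (2 * k) * r * r ^ μ := by
      rw [Real.rpow_add hr.1, Real.rpow_add_one hr.1.ne']
      congr 2
      exact_mod_cast Real.rpow_natCast r (2 * k)
    rw [e]
    push_cast
    ring
  rw [setIntegral_congr_fun measurableSet_Ioo hinner, integral_const_mul, integral_complex_ofReal,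
    integral_const_mul, ← integral_Ioc_eq_integral_Ioo, ← intervalIntegral.integral_of_le hR.le,
    integral_rpow (Or.inl (by linarith))]
  have e : 2 * (k : ℝ) + 1 + μ + 1 = 2 * k + 2 + μ := by ring
  rw [e, Real.zero_rpow hμ.ne', sub_zero, mul_div_assoc]

/-! ### Slices of the Hartogs triangle and Fubini -/

theorem mem_hartogsTriangle_iff {γ : ℝ} (hγ : 0 < γ) {x y : ℂ} :
    (x, y) ∈ hartogsTriangle γ ↔
      y ∈ Metric.ball (0 : ℂ) 1 ∧ x ∈ Metric.ball (0 : ℂ) (‖y‖ ^ γ⁻¹) := by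
  simp only [hartogsTriangle, Set.mem_ofPred_eq, mem_ball_zero_iff]
  rw [Real.lt_rpow_inv_iff_of_pos (norm_nonneg _) (norm_nonneg _) hγ, and_comm]

theorem isOpen_hartogsTriangle {γ : ℝ} (hγ : 0 < γ) : IsOpen (hartogsTriangle γ) := by
  have h1 : Continuous fun z : ℂ × ℂ => ‖z.1‖ ^ γ :=
    continuous_fst.norm.rpow_const fun _ => Or.inr hγ.le
  exact (isOpen_lt h1 continuous_snd.norm).inter (isOpen_lt continuous_snd.norm continuous_const)

theorem snd_ne_zero_of_mem_hartogsTriangle {γ : ℝ} {z : ℂ × ℂ} (hz : z ∈ hartogsTriangle γ) :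
    z.2 ≠ 0 := by
  have := lt_of_le_of_lt (Real.rpow_nonneg (norm_nonneg _) _) hz.1
  exact norm_pos_iff.1 this

theorem indicator_hartogsTriangle {γ : ℝ} (hγ : 0 < γ) {E : Type*} [Zero E] (F : ℂ × ℂ → E)
    (x y : ℂ) : (hartogsTriangle γ).indicator F (x, y) = (Metric.ball (0 : ℂ) 1).indicator
      (fun y => (Metric.ball (0 : ℂ) (‖y‖ ^ γ⁻¹)).indicator (fun x => F (x, y)) x) y := by
  classical
  simp only [Set.indicator_apply, mem_hartogsTriangle_iff hγ, ite_and]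

section Fubini

variable {E : Type*} [NormedAddCommGroup E] {γ : ℝ} {F : ℂ × ℂ → E}

theorem ae_integrableOn_slice (hγ : 0 < γ) (hF : IntegrableOn F (hartogsTriangle γ)) :
    ∀ᵐ y ∂volume.restrict (Metric.ball (0 : ℂ) 1),
      IntegrableOn (fun x => F (x, y)) (Metric.ball (0 : ℂ) (‖y‖ ^ γ⁻¹)) := by
  rw [← integrable_indicator_iff (isOpen_hartogsTriangle hγ).measurableSet,
    Measure.volume_eq_prod] at hF
  rw [ae_restrict_iff' Metric.isOpen_ball.measurableSet]
  filter_upwards [hF.prod_left_ae] with y hy hyb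
  simp only [indicator_hartogsTriangle hγ, Set.indicator_of_mem hyb] at hy
  rwa [← integrable_indicator_iff Metric.isOpen_ball.measurableSet]

variable [NormedSpace ℝ E]

theorem integral_slice_indicator (hγ : 0 < γ) (F : ℂ × ℂ → E) (y : ℂ) :
    ∫ x, (hartogsTriangle γ).indicator F (x, y) = (Metric.ball (0 : ℂ) 1).indicator
      (fun y => ∫ x in Metric.ball (0 : ℂ) (‖y‖ ^ γ⁻¹), F (x, y)) y := by
  simp only [indicator_hartogsTriangle hγ]
  by_cases hy : y ∈ Metric.ball (0 : ℂ) 1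
  · simp only [Set.indicator_of_mem hy]
    rw [integral_indicator Metric.isOpen_ball.measurableSet]
  · simp only [Set.indicator_of_notMem hy, integral_zero]

theorem integrableOn_integral_slice (hγ : 0 < γ) (hF : IntegrableOn F (hartogsTriangle γ)) :
    IntegrableOn (fun y => ∫ x in Metric.ball (0 : ℂ) (‖y‖ ^ γ⁻¹), F (x, y))
      (Metric.ball (0 : ℂ) 1) := by
  rw [← integrable_indicator_iff (isOpen_hartogsTriangle hγ).measurableSet,
    Measure.volume_eq_prod] at hF
  have := hF.integral_prod_right
  simp only [integral_slice_indicator hγ] at this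
  rwa [← integrable_indicator_iff Metric.isOpen_ball.measurableSet]

theorem setIntegral_hartogsTriangle (hγ : 0 < γ) (hF : IntegrableOn F (hartogsTriangle γ)) :
    ∫ z in hartogsTriangle γ, F z = ∫ y in Metric.ball (0 : ℂ) 1,
      ∫ x in Metric.ball (0 : ℂ) (‖y‖ ^ γ⁻¹), F (x, y) := by
  rw [← integrable_indicator_iff (isOpen_hartogsTriangle hγ).measurableSet,
    Measure.volume_eq_prod] at hF
  rw [← integral_indicator (isOpen_hartogsTriangle hγ).measurableSet, Measure.volume_eq_prod,
    integral_prod_symm _ hF, ← integral_indicator Metric.isOpen_ball.measurableSet]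
  simp only [integral_slice_indicator hγ]

end Fubini

theorem Complex.volume_real_ball (x : ℂ) {R : ℝ} (hR : 0 ≤ R) :
    volume.real (Metric.ball x R) = Real.pi * R ^ 2 := by
  rw [Measure.real, Complex.volume_ball, ENNReal.toReal_mul, ENNReal.toReal_pow,
    ENNReal.toReal_ofReal hR, mul_comm]
  rfl

/-- The slice over y has area π|y|^(2/γ), which reduces the question to |y|^(β + 2/γ) on the unit
disc. -/
theorem integrableOn_norm_snd_rpow {γ β : ℝ} (hγ : 0 < γ) (hβ : -2 < β + 2 * γ⁻¹) :
    IntegrableOn (fun z : ℂ × ℂ => ‖z.2‖ ^ β) (hartogsTriangle γ) := by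
  have hΩ := (isOpen_hartogsTriangle hγ).measurableSet
  rw [← integrable_indicator_iff hΩ, Measure.volume_eq_prod,
    integrable_prod_iff' ((Measurable.indicator (by fun_prop) hΩ).aestronglyMeasurable)]
  constructor
  · refine Filter.Eventually.of_forall fun y => ?_
    simp only [indicator_hartogsTriangle hγ]
    by_cases hy : y ∈ Metric.ball (0 : ℂ) 1
    · simp only [Set.indicator_of_mem hy]
      rw [integrable_indicator_iff Metric.isOpen_ball.measurableSet]
      exact integrableOn_const measure_ball_lt_top.ne
    · simp only [Set.indicator_of_notMem hy]
      exact integrable_zero _ _ _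
  · simp only [norm_indicator_eq_indicator_norm, integral_slice_indicator hγ]
    rw [integrable_indicator_iff Metric.isOpen_ball.measurableSet]
    have h1 := (integrableOn_ball_norm_rpow 1 hβ).const_mul Real.pi
    refine h1.congr ?_
    have h0 : ∀ᵐ y : ℂ ∂volume.restrict (Metric.ball (0 : ℂ) 1), y ≠ 0 :=
      ae_restrict_of_ae (by simp [ae_iff])
    filter_upwards [h0] with y hy
    have hy' : 0 < ‖y‖ := norm_pos_iff.2 hy
    rw [setIntegral_const, Complex.volume_real_ball _ (by positivity), Real.rpow_add hy',
      Real.norm_of_nonneg (by positivity), mul_comm 2 γ⁻¹, Real.rpow_mul hy'.le, smul_eq_mul]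
    norm_cast
    ring

theorem memLp_norm_snd_rpow {γ β : ℝ} (hγ : 0 < γ) (hβ : -1 < β + γ⁻¹) :
    MemLp (fun z : ℂ × ℂ => ‖z.2‖ ^ β) 2 (volume.restrict (hartogsTriangle γ)) := by
  rw [memLp_two_iff_integrable_sq (Measurable.aestronglyMeasurable (by fun_prop))]
  have h := integrableOn_norm_snd_rpow (β := β * 2) hγ (by linarith)
  refine h.congr (Filter.Eventually.of_forall fun z => ?_)
  simp only
  rw [Real.rpow_mul (norm_nonneg _)]
  norm_cast

/-- The part of the Hartogs triangle where `z₂` lies in a given set close to the origin. -/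
theorem volume_hartogsTriangle_inter_le {γ δ : ℝ} (hγ : 0 < γ) (hδ : 0 < δ) {B : Set ℂ}
    (hB : B ⊆ Metric.ball 0 δ) :
    volume.real (hartogsTriangle γ ∩ Prod.snd ⁻¹' B) ≤ Real.pi ^ 2 * δ ^ (2 * γ⁻¹ + 2) := by
  have hsub : hartogsTriangle γ ∩ Prod.snd ⁻¹' B ⊆
      Metric.ball (0 : ℂ) (δ ^ γ⁻¹) ×ˢ Metric.ball (0 : ℂ) δ := by
    rintro ⟨x, y⟩ ⟨hz, hy⟩
    have hyδ := hB hy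
    refine ⟨?_, hyδ⟩
    rw [mem_hartogsTriangle_iff hγ] at hz
    simp only [mem_ball_zero_iff] at hz hyδ ⊢
    exact hz.2.trans_le (Real.rpow_le_rpow (norm_nonneg _) hyδ.le (inv_nonneg.2 hγ.le))
  refine (measureReal_mono hsub ?_).trans ?_
  · rw [Measure.volume_eq_prod, Measure.prod_prod]
    exact (ENNReal.mul_lt_top measure_ball_lt_top measure_ball_lt_top).ne
  · rw [Measure.volume_eq_prod, measureReal_prod_prod, Complex.volume_real_ball _ (by positivity),
      Complex.volume_real_ball _ hδ.le, Real.rpow_add hδ, mul_comm 2 γ⁻¹, Real.rpow_mul hδ.le]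
    norm_cast
    apply le_of_eq
    ring

/-! ### Taylor coefficients in the first variable -/

open Filter Topology in
/-- Integrating a holomorphic function over a circle in the first variable. -/
theorem differentiableAt_integral_circleMap {U : Set (ℂ × ℂ)} (hU : IsOpen U) {F : ℂ × ℂ → ℂ}
    (hF : DifferentiableOn ℂ F U) {r R : ℝ} {y₀ : ℂ} (hR : 0 < R)
    (hsub : ∀ θ, ∀ y ∈ Metric.closedBall y₀ R, (circleMap 0 r θ, y) ∈ U) {φ : ℝ → ℂ}
    (hφ : Continuous φ) :
    DifferentiableAt ℂ (fun y => ∫ θ in (-Real.pi)..Real.pi, F (circleMap 0 r θ, y) * φ θ) y₀ := by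
  have hdiff : ∀ θ, ∀ y ∈ Metric.closedBall y₀ R,
      DifferentiableAt ℂ (fun y => F (circleMap 0 r θ, y)) y := fun θ y hy =>
    ((hF _ (hsub θ y hy)).differentiableAt (hU.mem_nhds (hsub θ y hy))).comp y (by fun_prop)
  have hcont : ∀ y ∈ Metric.closedBall y₀ R, Continuous fun θ => F (circleMap 0 r θ, y) :=
    fun y hy => hF.continuousOn.comp_continuous (by fun_prop) fun θ => hsub θ y hy
  obtain ⟨M, hM⟩ : ∃ M, ∀ θ, ∀ y ∈ Metric.closedBall y₀ R, ‖F (circleMap 0 r θ, y)‖ ≤ M := by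
    obtain ⟨M, hM⟩ := ((isCompact_sphere (0 : ℂ) |r|).prod
      (isCompact_closedBall y₀ R)).exists_bound_of_continuousOn (f := F) (by
        refine hF.continuousOn.mono ?_
        rintro ⟨x, y⟩ ⟨hx, hy⟩
        rw [← range_circleMap] at hx
        obtain ⟨θ, rfl⟩ := hx
        exact hsub θ y hy)
    exact ⟨M, fun θ y hy => hM _ ⟨by simp, hy⟩⟩
  -- Halving the radius leaves room for a Cauchy circle of radius R/2 around each such y; this gives
  -- the derivative bound M / (R/2).
  have hball : ∀ y ∈ Metric.ball y₀ (R / 2), Metric.closedBall y (R / 2) ⊆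
      Metric.closedBall y₀ R := fun y hy =>
    Metric.closedBall_subset_closedBall' (by rw [Metric.mem_ball] at hy; linarith)
  have hmem₀ : y₀ ∈ Metric.closedBall y₀ R := Metric.mem_closedBall_self hR.le
  have hsub2 : Metric.ball y₀ (R / 2) ⊆ Metric.closedBall y₀ R :=
    (Metric.ball_subset_ball (by linarith)).trans Metric.ball_subset_closedBall
  refine (intervalIntegral.hasDerivAt_integral_of_dominated_loc_of_deriv_le
    (F' := fun y θ => deriv (fun y => F (circleMap 0 r θ, y)) y * φ θ)
    (bound := fun θ => M / (R / 2) * ‖φ θ‖)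
    (Metric.ball_mem_nhds y₀ (half_pos hR)) ?_ ?_ ?_ ?_ ?_ ?_).2.differentiableAt
  · filter_upwards [Metric.ball_mem_nhds y₀ (half_pos hR)] with y hy
    exact ((hcont y (hsub2 hy)).mul hφ).aestronglyMeasurable
  · exact ((hcont y₀ hmem₀).mul hφ).intervalIntegrable _ _
  · refine AEStronglyMeasurable.mul ?_ hφ.aestronglyMeasurable
    have hpos : ∀ k : ℕ, 0 < R / 2 / ((k : ℝ) + 1) := fun k => by positivity
    -- Measurability in θ of the y-derivative: it is a pointwise limit of difference quotients along
    -- this sequence, each continuous in θ.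
    have hh : Tendsto (fun k : ℕ => ((R / 2 / ((k : ℝ) + 1) : ℝ) : ℂ)) atTop (𝓝[≠] 0) := by
      rw [tendsto_nhdsWithin_iff]
      refine ⟨?_, Eventually.of_forall fun k => by
        simpa using (Complex.ofReal_ne_zero.2 (hpos k).ne')⟩
      have h1 : Tendsto (fun k : ℕ => R / 2 / ((k : ℝ) + 1)) atTop (𝓝 0) := by
        simpa [div_eq_mul_inv] using (tendsto_one_div_add_atTop_nhds_zero_nat (𝕜 := ℝ)).const_mul
          (R / 2)
      have h2 := (Complex.continuous_ofReal.tendsto 0).comp h1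
      rwa [Complex.ofReal_zero] at h2
    refine aestronglyMeasurable_of_tendsto_ae atTop (f := fun (k : ℕ) θ =>
      ((R / 2 / ((k : ℝ) + 1) : ℝ) : ℂ)⁻¹ * (F (circleMap 0 r θ, y₀ + (R / 2 / ((k : ℝ) + 1) : ℝ)) -
        F (circleMap 0 r θ, y₀))) (fun k => ?_) (Eventually.of_forall fun θ => ?_)
    · have hmem : y₀ + (R / 2 / ((k : ℝ) + 1) : ℝ) ∈ Metric.closedBall y₀ R := by
        rw [Metric.mem_closedBall, dist_eq_norm, add_sub_cancel_left, Complex.norm_real,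
          Real.norm_of_nonneg (hpos k).le]
        have : R / 2 / ((k : ℝ) + 1) ≤ R / 2 := div_le_self (half_pos hR).le (by simp)
        linarith
      have h1 := hcont _ hmem
      have h2 := hcont _ hmem₀
      exact (continuous_const.mul (h1.sub h2)).aestronglyMeasurable
    · exact (hasDerivAt_iff_tendsto_slope_zero.1 (hdiff θ y₀ hmem₀).hasDerivAt).comp hh
  · refine Eventually.of_forall fun θ _ y hy => ?_
    rw [norm_mul]
    refine mul_le_mul_of_nonneg_right ?_ (norm_nonneg _)
    refine Complex.norm_deriv_le_of_forall_mem_sphere_norm_le (half_pos hR) ?_ fun η hη => ?_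
    · refine DifferentiableOn.diffContOnCl fun η hη => (hdiff θ η ?_).differentiableWithinAt
      rw [closure_ball _ (half_pos hR).ne'] at hη
      exact hball y hy hη
    · exact hM θ η (hball y hy (Metric.sphere_subset_closedBall hη))
  · exact (continuous_const.mul hφ.norm).intervalIntegrable _ _
  · refine Eventually.of_forall fun θ _ y hy => ?_
    exact ((hdiff θ y (hsub2 hy)).hasDerivAt).mul_const (φ θ)

/-- Taylor coefficients in the first variable at the origin. -/
def taylorCoeff (f : ℂ × ℂ → ℂ) (a : ℕ) (y : ℂ) : ℂ :=
  (a.factorial : ℂ)⁻¹ * iteratedDeriv a (fun x => f (x, y)) 0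

section Taylor

variable {γ : ℝ} {f : ℂ × ℂ → ℂ}

theorem differentiableOn_slice (hγ : 0 < γ) (hf : DifferentiableOn ℂ f (hartogsTriangle γ)) {y : ℂ}
    (hy : y ∈ Metric.ball (0 : ℂ) 1) :
    DifferentiableOn ℂ (fun x => f (x, y)) (Metric.ball (0 : ℂ) (‖y‖ ^ γ⁻¹)) :=
  hf.comp (by fun_prop) fun _ hx => (mem_hartogsTriangle_iff hγ).2 ⟨hy, hx⟩

theorem hasSum_taylorCoeff (hγ : 0 < γ) (hf : DifferentiableOn ℂ f (hartogsTriangle γ)) {x y : ℂ}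
    (h : (x, y) ∈ hartogsTriangle γ) :
    HasSum (fun a => taylorCoeff f a y * x ^ a) (f (x, y)) := by
  rw [mem_hartogsTriangle_iff hγ] at h
  have := Complex.hasSum_taylorSeries_on_ball (differentiableOn_slice hγ hf h.1) h.2
  refine (congrArg (fun F => HasSum F _) (funext fun a => ?_)).mpr this
  simp only [taylorCoeff, sub_zero, smul_eq_mul]
  ring

/-- With r fixed below |y₀|^(1/γ), the circle of radius r lies in all slices over y near y₀, so the
coefficient is locally an integral over one fixed circle. -/
theorem differentiableAt_taylorCoeff (hγ : 0 < γ) (hf : DifferentiableOn ℂ f (hartogsTriangle γ))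
    (a : ℕ) {y₀ : ℂ} (h₀ : y₀ ≠ 0) (h₁ : y₀ ∈ Metric.ball (0 : ℂ) 1) :
    DifferentiableAt ℂ (taylorCoeff f a) y₀ := by
  have hy₀ : 0 < ‖y₀‖ := norm_pos_iff.2 h₀
  obtain ⟨r, hr0, hr⟩ := exists_between (show 0 < ‖y₀‖ ^ γ⁻¹ by positivity)
  have hV : IsOpen {y : ℂ | r < ‖y‖ ^ γ⁻¹ ∧ ‖y‖ < 1} := by
    have h1 : Continuous fun y : ℂ => ‖y‖ ^ γ⁻¹ :=
      continuous_norm.rpow_const fun _ => Or.inr (inv_nonneg.2 hγ.le)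
    exact (isOpen_lt continuous_const h1).inter (isOpen_lt continuous_norm continuous_const)
  obtain ⟨R, hR, hRsub⟩ := Metric.nhds_basis_closedBall.mem_iff.1
    (hV.mem_nhds ⟨hr, by simpa using h₁⟩)
  have hsub : ∀ θ, ∀ y ∈ Metric.closedBall y₀ R,
      (circleMap 0 r θ, y) ∈ hartogsTriangle γ := fun θ y hy => by
    have := hRsub hy
    rw [mem_hartogsTriangle_iff hγ]
    simp only [mem_ball_zero_iff, norm_circleMap_zero, abs_of_pos hr0]
    exact ⟨this.2, this.1⟩
  have key : ∀ y ∈ Metric.closedBall y₀ R, taylorCoeff f a y =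
      (∫ θ in (-Real.pi)..Real.pi, f (circleMap 0 r θ, y) *
        (starRingEnd ℂ) (circleMap 0 r θ) ^ a) * (2 * Real.pi * r ^ (2 * a) : ℂ)⁻¹ := by
    intro y hy
    rw [integral_mul_conj_circleMap_pow (G := fun x => f (x, y))
      (fun θ => hasSum_taylorCoeff hγ hf (hsub θ y hy)) a]
    have : (r : ℂ) ≠ 0 := Complex.ofReal_ne_zero.2 hr0.ne'
    have : (Real.pi : ℂ) ≠ 0 := Complex.ofReal_ne_zero.2 Real.pi_ne_zero
    field_simp
  have hd := (differentiableAt_integral_circleMap (isOpen_hartogsTriangle hγ) hf hR hsub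
    (φ := fun θ => (starRingEnd ℂ) (circleMap 0 r θ) ^ a) (by fun_prop)).mul_const
    (2 * Real.pi * r ^ (2 * a) : ℂ)⁻¹
  refine hd.congr_of_eventuallyEq ?_
  filter_upwards [Metric.closedBall_mem_nhds y₀ hR] with y hy
  exact key y hy

/-- The moments of the slices. -/
theorem setIntegral_slice_mul_conj_pow (hγ : 0 < γ)
    (hf : DifferentiableOn ℂ f (hartogsTriangle γ)) (a : ℕ) {y : ℂ} (h₀ : y ≠ 0)
    (h₁ : y ∈ Metric.ball (0 : ℂ) 1)
    (hint : IntegrableOn (fun x => f (x, y) * (starRingEnd ℂ) x ^ a)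
      (Metric.ball (0 : ℂ) (‖y‖ ^ γ⁻¹))) :
    ∫ x in Metric.ball (0 : ℂ) (‖y‖ ^ γ⁻¹), f (x, y) * (starRingEnd ℂ) x ^ a =
      taylorCoeff f a y * (Real.pi / (a + 1) * (‖y‖ ^ γ⁻¹) ^ (2 * a + 2) : ℝ) := by
  have hy : 0 < ‖y‖ := norm_pos_iff.2 h₀
  have h := setIntegral_ball_mul_conj_pow (G := fun x => f (x, y)) (R := ‖y‖ ^ γ⁻¹) (by positivity)
    (differentiableOn_slice hγ hf h₁).continuousOn
    (fun x hx => hasSum_taylorCoeff hγ hf ((mem_hartogsTriangle_iff hγ).2 ⟨h₁, hx⟩)) a (μ := 0)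
    (by positivity) (by simpa using hint)
  simp only [Real.rpow_zero, Complex.ofReal_one, mul_one, add_zero] at h
  rw [h]
  have e : (‖y‖ ^ γ⁻¹) ^ (2 * (a : ℝ) + 2) = (‖y‖ ^ γ⁻¹) ^ (2 * a + 2) := by
    rw [← Real.rpow_natCast]
    push_cast
    rfl
  rw [e]
  congr 2
  field_simp

end Taylor

/-- The mean value property over discs. -/
theorem setIntegral_ball_eq_of_differentiableOn {g : ℂ → ℂ} {y : ℂ} {ρ : ℝ} (hρ : 0 < ρ)
    (hd : DifferentiableOn ℂ g (Metric.ball y ρ)) (hi : IntegrableOn g (Metric.ball y ρ)) :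
    ∫ w in Metric.ball y ρ, g w = g y * (Real.pi * ρ ^ 2 : ℝ) := by
  have hmp : MeasurePreserving (fun w : ℂ => y + w) volume volume :=
    measurePreserving_add_left volume y
  have hemb : MeasurableEmbedding (fun w : ℂ => y + w) := measurableEmbedding_addLeft y
  have hpre : (fun w : ℂ => y + w) ⁻¹' Metric.ball y ρ = Metric.ball 0 ρ := by
    ext w
    simp
  rw [← hmp.setIntegral_preimage_emb hemb, hpre]
  rw [← hmp.integrableOn_comp_preimage hemb, hpre] at hi
  have hd' : DifferentiableOn ℂ (fun w => g (y + w)) (Metric.ball 0 ρ) :=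
    hd.comp (by fun_prop) fun w hw => by simpa using hw
  have h := setIntegral_ball_mul_conj_pow (G := fun w => g (y + w))
    (c := fun l => (l.factorial : ℂ)⁻¹ * iteratedDeriv l (fun w => g (y + w)) 0) hρ
    hd'.continuousOn (fun w hw => by
      have := Complex.hasSum_taylorSeries_on_ball hd' hw
      refine (congrArg (fun F => HasSum F _) (funext fun a => ?_)).mpr this
      simp only [sub_zero, smul_eq_mul]
      ring) 0 (μ := 0) (by norm_num) (by simpa using! hi)
  simp only [pow_zero, Real.rpow_zero, Complex.ofReal_one, mul_one, add_zero, CharP.cast_eq_zero,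
    mul_zero, zero_add, Nat.factorial_zero, Nat.cast_one, inv_one, iteratedDeriv_zero,
    one_mul] at h
  rw [h, Real.rpow_ofNat, mul_div_assoc, mul_comm 2 Real.pi, mul_assoc,
    mul_div_cancel₀ _ two_ne_zero]

/-! ### Growth near z₂ = 0 and removal of the singularity -/

section Growth

variable {γ : ℝ} {f : ℂ × ℂ → ℂ}

/-- Solve the moment formula of the slice for the coefficient, estimating |x|^a by the a-th power of
the radius. -/
theorem norm_taylorCoeff_le (hγ : 0 < γ)
    (hf : DifferentiableOn ℂ f (hartogsTriangle γ)) (a : ℕ) {y : ℂ} (h₀ : y ≠ 0)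
    (h₁ : y ∈ Metric.ball (0 : ℂ) 1)
    (hint : IntegrableOn (fun x => f (x, y)) (Metric.ball (0 : ℂ) (‖y‖ ^ γ⁻¹))) :
    ‖taylorCoeff f a y‖ ≤ (a + 1) / (Real.pi * (‖y‖ ^ γ⁻¹) ^ (a + 2)) *
      ∫ x in Metric.ball (0 : ℂ) (‖y‖ ^ γ⁻¹), ‖f (x, y)‖ := by
  have hy : 0 < ‖y‖ := norm_pos_iff.2 h₀
  have hT : 0 < ‖y‖ ^ γ⁻¹ := by positivity
  set T := ‖y‖ ^ γ⁻¹
  have hle : ∀ᵐ x ∂volume.restrict (Metric.ball (0 : ℂ) T),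
      ‖f (x, y) * (starRingEnd ℂ) x ^ a‖ ≤ ‖f (x, y)‖ * T ^ a := by
    refine (ae_restrict_iff' Metric.isOpen_ball.measurableSet).2 (Filter.Eventually.of_forall
      fun x hx => ?_)
    rw [mem_ball_zero_iff] at hx
    rw [norm_mul, norm_pow, RCLike.norm_conj]
    gcongr
  have hint' : IntegrableOn (fun x => f (x, y) * (starRingEnd ℂ) x ^ a) (Metric.ball (0 : ℂ) T) :=
    (hint.norm.mul_const _).mono'
      (hint.1.mul (Continuous.aestronglyMeasurable (by fun_prop))) hle
  have h := setIntegral_slice_mul_conj_pow hγ hf a h₀ h₁ hint'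
  have h2 : ‖taylorCoeff f a y‖ * (Real.pi / (a + 1) * T ^ (2 * a + 2)) ≤
      (∫ x in Metric.ball (0 : ℂ) T, ‖f (x, y)‖) * T ^ a := by
    rw [← integral_mul_const, ← Real.norm_of_nonneg (show 0 ≤ Real.pi / (a + 1) * T ^ (2 * a + 2) by
      positivity), ← Complex.norm_real, ← norm_mul, ← h]
    exact norm_integral_le_of_norm_le (hint.norm.mul_const _) hle
  have h3 : (a + 1) / (Real.pi * T ^ (a + 2)) * (∫ x in Metric.ball (0 : ℂ) T, ‖f (x, y)‖) =
      ((∫ x in Metric.ball (0 : ℂ) T, ‖f (x, y)‖) * T ^ a) /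
        (Real.pi / (a + 1) * T ^ (2 * a + 2)) := by
    field_simp
    ring
  rw [h3, le_div_iff₀ (by positivity)]
  exact h2

/-- The constant 1 (the weight with β = 0) is square-integrable, so L² is contained in L¹ here. -/
theorem integrableOn_of_memBergmanSpace (hγ : 0 < γ)
    (hf : MemBergmanSpace (hartogsTriangle γ) f) : IntegrableOn f (hartogsTriangle γ) := by
  have h := (memLp_norm_snd_rpow (β := 0) hγ (by
    have := inv_pos.2 hγ
    linarith)).ofReal (K := ℂ)
  have h2 := hf.2.integrable_mul h
  refine h2.congr (Filter.Eventually.of_forall fun z => ?_)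
  simp

theorem integrableOn_norm_sq_of_memBergmanSpace (hf : MemBergmanSpace (hartogsTriangle γ) f) :
    IntegrableOn (fun z => ‖f z‖ ^ 2) (hartogsTriangle γ) := by
  have := hf.2.integrable_norm_pow two_ne_zero
  simpa only [ENNReal.toReal_ofNat, Real.rpow_ofNat, IntegrableOn] using this

/-- The integral of `|f|` over the part of the domain lying over a set `B`. -/
theorem setIntegral_integral_slice (hγ : 0 < γ) {F : ℂ × ℂ → ℝ}
    (hF : IntegrableOn F (hartogsTriangle γ)) {B : Set ℂ} (hB : MeasurableSet B)
    (hB1 : B ⊆ Metric.ball 0 1) :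
    ∫ y in B, ∫ x in Metric.ball (0 : ℂ) (‖y‖ ^ γ⁻¹), F (x, y) =
      ∫ z in hartogsTriangle γ ∩ Prod.snd ⁻¹' B, F z := by
  have hBm : MeasurableSet (Prod.snd ⁻¹' B : Set (ℂ × ℂ)) := measurable_snd hB
  rw [← setIntegral_indicator hBm, setIntegral_hartogsTriangle hγ
    (F := (Prod.snd ⁻¹' B).indicator F) (IntegrableOn.indicator hF hBm)]
  have : ∀ y, ∫ x in Metric.ball (0 : ℂ) (‖y‖ ^ γ⁻¹), (Prod.snd ⁻¹' B).indicator F (x, y) =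
      B.indicator (fun y => ∫ x in Metric.ball (0 : ℂ) (‖y‖ ^ γ⁻¹), F (x, y)) y := by
    intro y
    by_cases hy : y ∈ B
    · rw [Set.indicator_of_mem hy]
      congr 1
      ext x
      rw [Set.indicator_of_mem (by exact hy)]
    · rw [Set.indicator_of_notMem hy]
      have : ∀ x, (Prod.snd ⁻¹' B).indicator F (x, y) = 0 := fun x =>
        Set.indicator_of_notMem (by exact hy) _
      simp [this]
  simp_rw [this]
  rw [setIntegral_indicator hB, Set.inter_eq_self_of_subset_right hB1]

-- The sets decrease to the empty set, because z₂ ≠ 0 on the domain.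
open Filter Topology in
theorem exists_setIntegral_sq_le (hf : MemBergmanSpace (hartogsTriangle γ) f) (hγ : 0 < γ)
    {ε : ℝ} (hε : 0 < ε) :
    ∃ δ > 0, ∫ z in hartogsTriangle γ ∩ Prod.snd ⁻¹' (Metric.ball (0 : ℂ) δ), ‖f z‖ ^ 2 ≤ ε := by
  have hsq := integrableOn_norm_sq_of_memBergmanSpace hf
  set s : ℕ → Set (ℂ × ℂ) := fun k =>
    hartogsTriangle γ ∩ Prod.snd ⁻¹' (Metric.ball (0 : ℂ) (1 / ((k : ℝ) + 1)))
  have hs : ∀ k, MeasurableSet (s k) := fun k =>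
    (isOpen_hartogsTriangle hγ).measurableSet.inter
      (measurable_snd Metric.isOpen_ball.measurableSet)
  have hanti : Antitone s := fun k l hkl =>
    Set.inter_subset_inter_right _ (Set.preimage_mono (Metric.ball_subset_ball
      (one_div_le_one_div_of_le (by positivity) (by gcongr))))
  have hempty : ⋂ k, s k = ∅ := by
    refine Set.eq_empty_of_forall_notMem fun z hz => ?_
    rw [Set.mem_iInter] at hz
    have hz2 : 0 < ‖z.2‖ := norm_pos_iff.2 (snd_ne_zero_of_mem_hartogsTriangle (hz 0).1)
    obtain ⟨k, hk⟩ := exists_nat_one_div_lt hz2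
    have := (hz k).2
    rw [Set.mem_preimage, mem_ball_zero_iff] at this
    linarith
  have h := tendsto_setIntegral_of_antitone hs hanti (f := fun z => ‖f z‖ ^ 2) (μ := volume)
    ⟨0, hsq.mono_set Set.inter_subset_left⟩
  rw [hempty, setIntegral_empty] at h
  obtain ⟨k, hk⟩ := (h.eventually (gt_mem_nhds hε)).exists
  exact ⟨1 / ((k : ℝ) + 1), by positivity, hk.le⟩

-- Put Y = |y| and T = Y^(1/γ). The mean value property on the disc B of radius Y/2 about y, with
-- the slice bound, controls |c_a(y)| Y² T^(a+2) by the L¹ norm of f over B. That part of the domain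
-- has volume O((TY)²) and carries arbitrarily small L² mass as y → 0, so the L¹ norm is o(TY). The
-- gain from O to o is needed when m ∣ n(a+1), where clearing the pole leaves no spare power of y.
open Filter Topology in
theorem norm_taylorCoeff_mul_le (hf : MemBergmanSpace (hartogsTriangle γ) f) (hγ : 0 < γ) (a : ℕ)
    {ε : ℝ} (hε : 0 < ε) :
    ∀ᶠ y in 𝓝[≠] (0 : ℂ), ‖taylorCoeff f a y‖ * (‖y‖ * (‖y‖ ^ γ⁻¹) ^ (a + 1)) ≤ ε := by
  -- `c` compares the slice radii over B with T, `C₀` comes from the L¹ estimate over B, and `C`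
  -- collects all factors; L² mass at most (ε/C)² then yields exactly ε.
  set c : ℝ := (1 / 2) ^ γ⁻¹ with hc
  have hc0 : 0 < c := by positivity
  set C₀ : ℝ := 1 / 2 + 1 / 2 * Real.pi ^ 2 * 2 ^ (2 * γ⁻¹ + 2) with hC₀
  have hC₀0 : 0 < C₀ := by positivity
  set C : ℝ := 4 * (a + 1) * C₀ / (Real.pi ^ 2 * c ^ (a + 2)) with hC
  have hC0 : 0 < C := by positivity
  set e : ℝ := ε / C with he
  have he0 : 0 < e := by positivity
  have hfi := integrableOn_of_memBergmanSpace hγ hf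
  have hsq := integrableOn_norm_sq_of_memBergmanSpace hf
  obtain ⟨δ, hδ, hδI⟩ := exists_setIntegral_sq_le hf hγ (pow_pos he0 2)
  -- B lies in the disc of radius 2Y, which must fit inside both the unit disc and the disc of
  -- radius δ.
  have hnhds : Metric.ball (0 : ℂ) (min (1 / 2) (δ / 2)) ∈ 𝓝[≠] (0 : ℂ) :=
    mem_nhdsWithin_of_mem_nhds (Metric.ball_mem_nhds _ (by positivity))
  filter_upwards [hnhds, self_mem_nhdsWithin] with y hy hy0
  rw [mem_ball_zero_iff, lt_min_iff] at hy
  set Y := ‖y‖ with hYdef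
  have hY : 0 < Y := norm_pos_iff.2 hy0
  set T := Y ^ γ⁻¹ with hTdef
  have hT : 0 < T := by positivity
  set B := Metric.ball y (Y / 2) with hB
  have hBm : MeasurableSet B := Metric.isOpen_ball.measurableSet
  have hclosed : ∀ η ∈ Metric.closedBall y (Y / 2), Y / 2 ≤ ‖η‖ ∧ ‖η‖ < 2 * Y := by
    intro η hη
    rw [Metric.mem_closedBall, dist_eq_norm] at hη
    have h1 := norm_sub_norm_le y η
    rw [norm_sub_rev] at h1
    have h2 := norm_sub_norm_le η y
    constructor <;> linarith
  have hBB : ∀ η ∈ B, Y / 2 ≤ ‖η‖ ∧ ‖η‖ < 2 * Y := fun η hη =>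
    hclosed η (Metric.ball_subset_closedBall hη)
  have hdiff : ∀ η ∈ Metric.closedBall y (Y / 2), DifferentiableAt ℂ (taylorCoeff f a) η := by
    intro η hη
    have := hclosed η hη
    refine differentiableAt_taylorCoeff hγ hf.1 a (norm_pos_iff.1 (by linarith)) ?_
    rw [mem_ball_zero_iff]
    linarith
  have hgi : IntegrableOn (taylorCoeff f a) B :=
    (ContinuousOn.integrableOn_compact (isCompact_closedBall y (Y / 2)) fun η hη =>
      (hdiff η hη).continuousAt.continuousWithinAt).mono_set Metric.ball_subset_closedBall
  have hB1 : B ⊆ Metric.ball 0 1 := fun η hη => by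
    rw [mem_ball_zero_iff]
    linarith [(hBB η hη).2]
  have hmean := setIntegral_ball_eq_of_differentiableOn (half_pos hY)
    (fun η hη => (hdiff η (Metric.ball_subset_closedBall hη)).differentiableWithinAt) hgi
  set D : ℝ := (a + 1) / (Real.pi * (c * T) ^ (a + 2)) with hD
  have hcT : c * T = (Y / 2) ^ γ⁻¹ := by
    rw [hc, hTdef, ← Real.mul_rpow (by norm_num) hY.le]
    congr 1
    ring
  have hhi : IntegrableOn (fun η => ∫ x in Metric.ball (0 : ℂ) (‖η‖ ^ γ⁻¹), ‖f (x, η)‖) B :=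
    (integrableOn_integral_slice hγ hfi.norm).mono_set hB1
  have hstep1 : ‖taylorCoeff f a y‖ * (Real.pi * (Y / 2) ^ 2) ≤
      D * ∫ η in B, ∫ x in Metric.ball (0 : ℂ) (‖η‖ ^ γ⁻¹), ‖f (x, η)‖ := by
    have h1 : ‖∫ w in B, taylorCoeff f a w‖ = ‖taylorCoeff f a y‖ * (Real.pi * (Y / 2) ^ 2) := by
      rw [hmean, norm_mul, Complex.norm_real, Real.norm_of_nonneg (by positivity)]
    rw [← h1, ← integral_const_mul]
    refine norm_integral_le_of_norm_le (hhi.const_mul D) ?_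
    have hsl := ae_mono (Measure.restrict_mono hB1 le_rfl) (ae_integrableOn_slice hγ hfi)
    filter_upwards [hsl, ae_restrict_mem hBm] with η hη hηB
    have hb := hBB η hηB
    refine (norm_taylorCoeff_le hγ hf.1 a (norm_pos_iff.1 (by linarith)) (hB1 hηB) hη).trans ?_
    refine mul_le_mul_of_nonneg_right ?_ (integral_nonneg fun _ => norm_nonneg _)
    have h2 : c * T ≤ ‖η‖ ^ γ⁻¹ := by
      rw [hcT]
      exact Real.rpow_le_rpow (by positivity) hb.1 (inv_nonneg.2 hγ.le)
    rw [hD]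
    gcongr
  set S := hartogsTriangle γ ∩ Prod.snd ⁻¹' B with hS
  have hSΩ : S ⊆ hartogsTriangle γ := Set.inter_subset_left
  rw [setIntegral_integral_slice hγ hfi.norm hBm hB1] at hstep1
  have hB2 : B ⊆ Metric.ball 0 (2 * Y) := fun η hη => by
    rw [mem_ball_zero_iff]; exact (hBB η hη).2
  have hvol := volume_hartogsTriangle_inter_le hγ (by positivity) hB2
  have hI : ∫ z in S, ‖f z‖ ^ 2 ≤ e ^ 2 := by
    refine (setIntegral_mono_set (hsq.mono_set Set.inter_subset_left)
      (Eventually.of_forall fun z => by positivity) ?_).trans hδI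
    refine LE.le.eventuallyLE (Set.inter_subset_inter_right _ (Set.preimage_mono ?_))
    refine hB2.trans (Metric.ball_subset_ball (by linarith))
  have hSfin : volume S ≠ ⊤ := by
    have hsub : S ⊆ Metric.ball (0 : ℂ) 1 ×ˢ Metric.ball (0 : ℂ) 1 := by
      rintro ⟨x, η⟩ hz
      have hz' := (mem_hartogsTriangle_iff hγ).1 (hSΩ hz)
      refine ⟨?_, hz'.1⟩
      simp only [mem_ball_zero_iff] at hz' ⊢
      exact hz'.2.trans_le (Real.rpow_le_one (norm_nonneg _) hz'.1.le (inv_nonneg.2 hγ.le))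
    refine ne_top_of_le_ne_top ?_ (measure_mono hsub)
    rw [Measure.volume_eq_prod, Measure.prod_prod]
    exact (ENNReal.mul_lt_top measure_ball_lt_top measure_ball_lt_top).ne
  -- Cauchy–Schwarz in the form |f| ≤ |f|²/(2τ) + τ/2; this τ gives both integrals the order e·TY.
  set τ : ℝ := e / (T * Y) with hτ
  have hτ0 : 0 < τ := by positivity
  have hstep2 : ∫ z in S, ‖f z‖ ≤ e * (T * Y) * C₀ := by
    have h1 : ∫ z in S, ‖f z‖ ≤ ∫ z in S, (‖f z‖ ^ 2 * (1 / (2 * τ)) + τ / 2) := by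
      refine setIntegral_mono (IntegrableOn.mono_set hfi.norm hSΩ)
        (((hsq.mono_set hSΩ).mul_const _).add (integrableOn_const hSfin)) fun z => ?_
      have : ‖f z‖ ^ 2 * (1 / (2 * τ)) + τ / 2 - ‖f z‖ = (‖f z‖ - τ) ^ 2 / (2 * τ) := by
        field_simp
        ring
      have h2 : 0 ≤ (‖f z‖ - τ) ^ 2 / (2 * τ) := by positivity
      simp only
      linarith
    refine h1.trans ?_
    rw [integral_add ((hsq.mono_set hSΩ).mul_const _) (integrableOn_const hSfin),
      integral_mul_const, setIntegral_const, smul_eq_mul]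
    have hpow : (2 * Y) ^ (2 * γ⁻¹ + 2) = 2 ^ (2 * γ⁻¹ + 2) * (T * Y) ^ 2 := by
      rw [Real.mul_rpow (by norm_num) hY.le, Real.rpow_add hY, mul_comm 2 γ⁻¹,
        Real.rpow_mul hY.le]
      norm_cast
      rw [mul_pow]
    rw [hpow] at hvol
    calc (∫ z in S, ‖f z‖ ^ 2) * (1 / (2 * τ)) + volume.real S * (τ / 2)
        ≤ e ^ 2 * (1 / (2 * τ)) +
          Real.pi ^ 2 * (2 ^ (2 * γ⁻¹ + 2) * (T * Y) ^ 2) * (τ / 2) := by gcongr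
      _ = e * (T * Y) * C₀ := by
        rw [hτ, hC₀]
        field_simp
  have hstep3 : ‖taylorCoeff f a y‖ * (Real.pi * (Y / 2) ^ 2) ≤ D * (e * (T * Y) * C₀) :=
    hstep1.trans (mul_le_mul_of_nonneg_left hstep2 (by positivity))
  calc ‖taylorCoeff f a y‖ * (Y * T ^ (a + 1))
      = ‖taylorCoeff f a y‖ * (Real.pi * (Y / 2) ^ 2) * (4 * T ^ (a + 1) / (Real.pi * Y)) := by
        field_simp
        ring
    _ ≤ D * (e * (T * Y) * C₀) * (4 * T ^ (a + 1) / (Real.pi * Y)) := by gcongr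
    _ = e * C := by
        rw [hD, hC, mul_pow c T]
        field_simp
        ring
    _ = ε := by rw [he]; field_simp

-- Since |y|^l ≤ (|y|^(1/γ))^(a+1) on the unit disc, the growth estimate makes the product o(1/|y|),
-- and Riemann's removable singularity theorem applies.
open Filter Topology in
theorem exists_differentiableOn_pow_mul_taylorCoeff (hf : MemBergmanSpace (hartogsTriangle γ) f)
    (hγ : 0 < γ) (a : ℕ) {l : ℕ} (hl : γ⁻¹ * (a + 1) ≤ l) :
    ∃ H : ℂ → ℂ, DifferentiableOn ℂ H (Metric.ball 0 1) ∧
      ∀ y ∈ Metric.ball (0 : ℂ) 1, y ≠ 0 → y ^ l * taylorCoeff f a y = H y := by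
  -- A positive power kills the meaningless value of the coefficient at 0, so the value subtracted
  -- in the little-o criterion is zero.
  have hl0 : l ≠ 0 := by
    rintro rfl
    have : 0 < γ⁻¹ * (a + 1) := by positivity
    simp only [CharP.cast_eq_zero] at hl
    linarith
  have h := Complex.differentiableOn_update_limUnder_of_isLittleO
    (f := fun y => y ^ l * taylorCoeff f a y) (c := 0) (Metric.ball_mem_nhds (0 : ℂ) one_pos)
    (fun y hy => (DifferentiableAt.mul (by fun_prop)
      (differentiableAt_taylorCoeff hγ hf.1 a hy.2 hy.1)).differentiableWithinAt) (by
      simp only [zero_pow hl0, zero_mul, sub_zero]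
      rw [Asymptotics.isLittleO_iff]
      intro ε hε
      filter_upwards [norm_taylorCoeff_mul_le hf hγ a hε, self_mem_nhdsWithin,
        mem_nhdsWithin_of_mem_nhds (Metric.ball_mem_nhds (0 : ℂ) one_pos)] with y hy hy0 hy1
      have hY : 0 < ‖y‖ := norm_pos_iff.2 hy0
      rw [mem_ball_zero_iff] at hy1
      have hT : ‖y‖ ^ l ≤ (‖y‖ ^ γ⁻¹) ^ (a + 1) := by
        rw [← Real.rpow_natCast, ← Real.rpow_natCast, ← Real.rpow_mul hY.le]
        refine Real.rpow_le_rpow_of_exponent_ge hY hy1.le ?_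
        push_cast
        exact hl
      rw [norm_mul, norm_pow, norm_inv, ← div_eq_mul_inv, le_div_iff₀ hY]
      refine le_trans ?_ hy
      calc ‖y‖ ^ l * ‖taylorCoeff f a y‖ * ‖y‖ ≤
          (‖y‖ ^ γ⁻¹) ^ (a + 1) * ‖taylorCoeff f a y‖ * ‖y‖ := by gcongr
        _ = _ := by ring)
  exact ⟨_, h, fun y _ hy => by rw [Function.update_of_ne hy]⟩

end Growth

/-! ### The kernel of the rational Hartogs triangle and its reproducing property -/

theorem HasSum.sum_residueClasses {f : ℕ → ℂ} {x : ℂ} (h : HasSum f x) {m : ℕ} (hm : 0 < m)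
    {I : ℕ → ℂ} (hI : ∀ j < m, HasSum (fun q => f (j + m * q)) (I j)) :
    ∑ j ∈ Finset.range m, I j = x := by
  have : NeZero m := ⟨hm.ne'⟩
  have h1 := ((Equiv.prodComm (Fin m) ℕ).trans (Nat.divModEquiv m).symm).hasSum_iff.mpr h
  have h2 := h1.prod_fiberwise (g := fun j : Fin m => I j) fun j => by
    refine (congrArg (fun F => HasSum F _) (funext fun q => ?_)).mpr (hI j j.2)
    simp only [Function.comp_apply, Equiv.trans_apply, Equiv.prodComm_apply, Prod.swap_prod_mk,
      Nat.divModEquiv_symm_apply]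
    congr 1
    ring
  rw [Finset.sum_range]
  exact (hasSum_fintype _).unique h2

namespace HartogsKernel

open ComplexConjugate

section Domain

variable {m n : ℕ}

theorem norm_pow_lt (hn : 0 < n) {z : ℂ × ℂ}
    (hz : z ∈ hartogsTriangle ((m : ℝ) / n)) : ‖z.1‖ ^ m < ‖z.2‖ ^ n := by
  have h := pow_lt_pow_left₀ hz.1 (Real.rpow_nonneg (norm_nonneg _) _) hn.ne'
  have hn' : (n : ℝ) ≠ 0 := by positivity
  rwa [← Real.rpow_natCast (_ ^ _) n, ← Real.rpow_mul (norm_nonneg _), div_mul_cancel₀ _ hn',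
    Real.rpow_natCast] at h

theorem norm_mul_conj_pow_lt (hn : 0 < n) {z w : ℂ × ℂ}
    (hz : z ∈ hartogsTriangle ((m : ℝ) / n)) (hw : w ∈ hartogsTriangle ((m : ℝ) / n)) :
    ‖z.1 * conj w.1‖ ^ m < ‖z.2 * conj w.2‖ ^ n := by
  rw [norm_mul, norm_mul, mul_pow, mul_pow, RCLike.norm_conj, RCLike.norm_conj]
  exact mul_lt_mul'' (norm_pow_lt hn hz) (norm_pow_lt hn hw) (by positivity) (by positivity)

theorem mul_conj_snd_ne_zero {γ : ℝ} {z w : ℂ × ℂ}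
    (hz : z ∈ hartogsTriangle γ) (hw : w ∈ hartogsTriangle γ) : z.2 * conj w.2 ≠ 0 :=
  mul_ne_zero (snd_ne_zero_of_mem_hartogsTriangle hz)
    ((map_ne_zero _).2 (snd_ne_zero_of_mem_hartogsTriangle hw))

theorem norm_mul_conj_snd_lt {γ : ℝ} {z w : ℂ × ℂ}
    (hz : z ∈ hartogsTriangle γ) (hw : w ∈ hartogsTriangle γ) : ‖z.2 * conj w.2‖ < 1 := by
  rw [norm_mul, RCLike.norm_conj]
  exact mul_lt_one_of_nonneg_of_lt_one_left (norm_nonneg _) hz.2 hw.2.le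

theorem denominator_ne_zero {s t : ℂ} (ht : ‖t‖ < 1) (hst : ‖s‖ ^ m < ‖t‖ ^ n) :
    (1 - t) ^ 2 * (t ^ n - s ^ m) ^ 2 ≠ 0 := by
  refine mul_ne_zero (pow_ne_zero _ fun h => ?_) (pow_ne_zero _ fun h => ?_)
  · rw [sub_eq_zero] at h
    simp [← h] at ht
  · rw [sub_eq_zero] at h
    rw [← norm_pow, ← norm_pow, h] at hst
    exact lt_irrefl _ hst

/-- The exponent of a radial function of `z₂` dominating all square-integrable monomials. -/
def domExp (m n : ℕ) : ℝ := 1 / m - 1 - n / m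

theorem ell_eq (hm : 0 < m) (a : ℕ) :
    (ell m n a : ℝ) = n / m * (a + 1) + 1 - res m n a / m := by
  have h : (m * ell m n a + res m n a : ℝ) = n * (a + 1) + m := by
    exact_mod_cast mul_ell_add_res hm n a
  have hm' : (m : ℝ) ≠ 0 := by positivity
  field_simp
  linarith

/-- Using |z₁| < |z₂|^(n/m), the exponent of |z₂| becomes k + `res`/m - 1 - n/m, which is smallest
for k = 0 and `res` = 1. The bound is uniform in a and k. -/
theorem norm_monomial_le (hm : 0 < m) (hn : 0 < n) (a k : ℕ) {z : ℂ × ℂ}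
    (hz : z ∈ hartogsTriangle ((m : ℝ) / n)) :
    ‖z.1 ^ a * z.2 ^ ((k : ℤ) - ell m n a)‖ ≤ ‖z.2‖ ^ domExp m n := by
  have hm' : (0 : ℝ) < m := by positivity
  have hγ : (0 : ℝ) < m / n := by positivity
  have hY : 0 < ‖z.2‖ := norm_pos_iff.2 (snd_ne_zero_of_mem_hartogsTriangle hz)
  have hx := ((mem_hartogsTriangle_iff (x := z.1) (y := z.2) hγ).1 hz).2
  rw [mem_ball_zero_iff, inv_div] at hx
  rw [norm_mul, norm_pow, norm_zpow, ← Real.rpow_intCast]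
  calc ‖z.1‖ ^ a * ‖z.2‖ ^ (((k : ℤ) - ell m n a : ℤ) : ℝ)
      ≤ (‖z.2‖ ^ ((n : ℝ) / m)) ^ a * ‖z.2‖ ^ (((k : ℤ) - ell m n a : ℤ) : ℝ) := by gcongr
    _ = ‖z.2‖ ^ ((n : ℝ) / m * a + (k - ell m n a)) := by
      rw [← Real.rpow_natCast, ← Real.rpow_mul hY.le, ← Real.rpow_add hY]
      push_cast
      rfl
    _ ≤ ‖z.2‖ ^ domExp m n := by
      refine Real.rpow_le_rpow_of_exponent_ge hY hz.2.le ?_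
      rw [ell_eq hm, domExp]
      have h1 : (1 : ℝ) / m ≤ res m n a / m := by
        gcongr
        exact_mod_cast res_pos m n a
      have : (0 : ℝ) ≤ k := by positivity
      linarith

theorem memLp_dom (hm : 0 < m) (hn : 0 < n) :
    MemLp (fun z : ℂ × ℂ => ‖z.2‖ ^ domExp m n) 2
      (volume.restrict (hartogsTriangle ((m : ℝ) / n))) := by
  have hm' : (0 : ℝ) < m := by positivity
  refine memLp_norm_snd_rpow (by positivity) ?_
  rw [domExp, inv_div]
  have : (0 : ℝ) < 1 / m := by positivity
  linarith

theorem kerTerm_mul_conj (m n : ℕ) (z w : ℂ × ℂ) (a k : ℕ) :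
    kerTerm m n (z.1 * conj w.1) (z.2 * conj w.2) a k =
      kerTerm m n z.1 z.2 a k * conj (w.1 ^ a * w.2 ^ ((k : ℤ) - ell m n a)) := by
  simp only [kerTerm, mul_pow, mul_zpow, map_mul, map_pow, map_zpow₀]
  ring

theorem conj_kerTerm (m n : ℕ) (s t : ℂ) (a k : ℕ) :
    conj (kerTerm m n s t a k) = kerTerm m n (conj s) (conj t) a k := by
  simp [kerTerm]

/-- The part of the kernel that comes from a residue class modulo `m`. -/
def kerPart (m n j : ℕ) (s t : ℂ) : ℂ :=
  s ^ j * t ^ (n - ell m n j) * ((res m n j : ℂ) + (m - res m n j) * t) *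
    ((j + 1) * t ^ n + (m - j - 1) * s ^ m) / ((1 - t) ^ 2 * (t ^ n - s ^ m) ^ 2)

theorem hasSum_kerPart (hm : 0 < m) (hn : 0 < n) {z w : ℂ × ℂ}
    (hz : z ∈ hartogsTriangle ((m : ℝ) / n)) (hw : w ∈ hartogsTriangle ((m : ℝ) / n))
    {j : ℕ} (hj : j < m) :
    HasSum (fun p : ℕ × ℕ => kerTerm m n (z.1 * conj w.1) (z.2 * conj w.2) (j + m * p.1) p.2)
      (kerPart m n j (z.1 * conj w.1) (z.2 * conj w.2)) :=
  hasSum_kerTerm hm (mul_conj_snd_ne_zero hz hw) (norm_mul_conj_snd_lt hz hw)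
    (norm_mul_conj_pow_lt hn hz hw) hj

/-- The series is evaluated at (s, t) = z itself, which meets the same inequalities. After
separating variables, all weights can thus stay on one point while the monomials in the other are
dominated uniformly. -/
theorem summable_norm_kerTerm (hm : 0 < m) (hn : 0 < n) {z : ℂ × ℂ}
    (hz : z ∈ hartogsTriangle ((m : ℝ) / n)) {j : ℕ} (hj : j < m) :
    Summable fun p : ℕ × ℕ => ‖kerTerm m n z.1 z.2 (j + m * p.1) p.2‖ :=
  (hasSum_kerTerm hm (snd_ne_zero_of_mem_hartogsTriangle hz) hz.2 (norm_pow_lt hn hz)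
    hj).summable.norm

theorem conj_kerPart (m n j : ℕ) (s t : ℂ) :
    conj (kerPart m n j s t) = kerPart m n j (conj s) (conj t) := by
  simp [kerPart]

theorem memBergmanSpace_kerPart (hm : 0 < m) (hn : 0 < n) {w : ℂ × ℂ}
    (hw : w ∈ hartogsTriangle ((m : ℝ) / n)) {j : ℕ} (hj : j < m) :
    MemBergmanSpace (hartogsTriangle ((m : ℝ) / n))
      fun z => kerPart m n j (z.1 * conj w.1) (z.2 * conj w.2) := by
  have hγ : (0 : ℝ) < m / n := by positivity
  have hΩ := (isOpen_hartogsTriangle hγ).measurableSet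
  have hd : DifferentiableOn ℂ (fun z : ℂ × ℂ => kerPart m n j (z.1 * conj w.1) (z.2 * conj w.2))
      (hartogsTriangle ((m : ℝ) / n)) := by
    unfold kerPart
    intro z hz
    have := denominator_ne_zero (norm_mul_conj_snd_lt hz hw) (norm_mul_conj_pow_lt hn hz hw)
    exact DifferentiableAt.differentiableWithinAt (by fun_prop (disch := exact this))
  refine ⟨hd, (memLp_dom hm hn).of_le_mul (c := ∑' p : ℕ × ℕ,
    ‖kerTerm m n w.1 w.2 (j + m * p.1) p.2‖) (hd.continuousOn.aestronglyMeasurable hΩ) ?_⟩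
  filter_upwards [ae_restrict_mem hΩ] with z hz
  have hle : ∀ p : ℕ × ℕ,
      ‖kerTerm m n (z.1 * conj w.1) (z.2 * conj w.2) (j + m * p.1) p.2‖ ≤
        ‖kerTerm m n w.1 w.2 (j + m * p.1) p.2‖ * ‖‖z.2‖ ^ domExp m n‖ := by
    intro p
    -- Conjugation exchanges z and w, so the weighted factor sits at the fixed point w.
    rw [← RCLike.norm_conj, conj_kerTerm, map_mul, map_mul, Complex.conj_conj, Complex.conj_conj,
      mul_comm _ w.1, mul_comm _ w.2, kerTerm_mul_conj, norm_mul, RCLike.norm_conj]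
    refine mul_le_mul_of_nonneg_left ?_ (norm_nonneg _)
    exact (norm_monomial_le hm hn _ _ hz).trans (le_abs_self _)
  rw [← (hasSum_kerPart hm hn hz hw hj).tsum_eq, ← tsum_mul_right]
  exact tsum_of_norm_bounded (((summable_norm_kerTerm hm hn hw hj).mul_right _).hasSum) hle

theorem integrableOn_mul_conj_monomial (hm : 0 < m) (hn : 0 < n) {f : ℂ × ℂ → ℂ}
    (hf : MemBergmanSpace (hartogsTriangle ((m : ℝ) / n)) f) (a k : ℕ) :
    IntegrableOn (fun w => f w * conj (w.1 ^ a * w.2 ^ ((k : ℤ) - ell m n a)))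
        (hartogsTriangle ((m : ℝ) / n)) ∧
      ∫ w in hartogsTriangle ((m : ℝ) / n),
        ‖f w * conj (w.1 ^ a * w.2 ^ ((k : ℤ) - ell m n a))‖ ≤
        ∫ w in hartogsTriangle ((m : ℝ) / n), ‖f w‖ * ‖w.2‖ ^ domExp m n := by
  have hγ : (0 : ℝ) < m / n := by positivity
  have hΩ := (isOpen_hartogsTriangle hγ).measurableSet
  have hint : IntegrableOn (fun w => ‖f w‖ * ‖w.2‖ ^ domExp m n)
      (hartogsTriangle ((m : ℝ) / n)) := hf.2.norm.integrable_mul (memLp_dom hm hn)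
  have hle : ∀ w ∈ hartogsTriangle ((m : ℝ) / n),
      ‖f w * conj (w.1 ^ a * w.2 ^ ((k : ℤ) - ell m n a))‖ ≤ ‖f w‖ * ‖w.2‖ ^ domExp m n := by
    intro w hw
    rw [norm_mul, RCLike.norm_conj]
    exact mul_le_mul_of_nonneg_left (norm_monomial_le hm hn a k hw) (norm_nonneg _)
  have hi : IntegrableOn (fun w => f w * conj (w.1 ^ a * w.2 ^ ((k : ℤ) - ell m n a)))
      (hartogsTriangle ((m : ℝ) / n)) := by
    refine Integrable.mono' hint (hf.2.1.mul ?_)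
      ((ae_restrict_iff' hΩ).2 (Filter.Eventually.of_forall hle))
    refine ContinuousOn.aestronglyMeasurable ?_ hΩ
    refine Complex.continuous_conj.comp_continuousOn (ContinuousOn.mul (by fun_prop) ?_)
    exact ContinuousOn.zpow₀ (by fun_prop) _
      fun z hz => Or.inl (snd_ne_zero_of_mem_hartogsTriangle hz)
  exact ⟨hi, setIntegral_mono_on hi.norm hint hΩ hle⟩

/-- The Laurent coefficients of an element of the Bergman space are its normalized inner
products with the monomials. -/
theorem setIntegral_mul_conj_monomial (hm : 0 < m) (hn : 0 < n) {f : ℂ × ℂ → ℂ}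
    (hf : MemBergmanSpace (hartogsTriangle ((m : ℝ) / n)) f) {a : ℕ} {H : ℂ → ℂ} {h : ℕ → ℂ}
    (hH : DifferentiableOn ℂ H (Metric.ball 0 1))
    (hfH : ∀ y ∈ Metric.ball (0 : ℂ) 1, y ≠ 0 → y ^ ell m n a * taylorCoeff f a y = H y)
    (hsum : ∀ y ∈ Metric.ball (0 : ℂ) 1, HasSum (fun k => h k * y ^ k) (H y)) (k : ℕ) :
    ∫ w in hartogsTriangle ((m : ℝ) / n), f w * conj (w.1 ^ a * w.2 ^ ((k : ℤ) - ell m n a)) =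
      h k * (Real.pi ^ 2 * m / ((a + 1) * (res m n a + m * k)) : ℝ) := by
  have hγ : (0 : ℝ) < m / n := by positivity
  have hm' : (0 : ℝ) < m := by positivity
  have hres : (0 : ℝ) < res m n a := by exact_mod_cast res_pos m n a
  have hint := (integrableOn_mul_conj_monomial hm hn hf a k).1
  -- The slice moment contributes |y|^(2n(a+1)/m); the factors y^(-`ell`) from c_a and its conjugate
  -- from the monomial contribute |y|^(-2`ell`).
  set μ : ℝ := 2 * ((n : ℝ) / m * (a + 1) - ell m n a) with hμ
  have hμe : 2 * (k : ℝ) + 2 + μ = 2 * (res m n a + m * k) / m := by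
    rw [hμ, ell_eq hm]
    field_simp
    ring
  have hslice : ∀ᵐ y ∂volume.restrict (Metric.ball (0 : ℂ) 1),
      ∫ x in Metric.ball (0 : ℂ) (‖y‖ ^ ((m : ℝ) / n)⁻¹),
        f (x, y) * conj (x ^ a * y ^ ((k : ℤ) - ell m n a)) =
      (H y * conj y ^ k * (‖y‖ ^ μ : ℝ)) * (Real.pi / (a + 1) : ℝ) := by
    have h0 : ∀ᵐ y : ℂ ∂volume.restrict (Metric.ball (0 : ℂ) 1), y ≠ 0 :=
      ae_restrict_of_ae (by simp [ae_iff])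
    filter_upwards [ae_integrableOn_slice hγ hint, h0,
      ae_restrict_mem Metric.isOpen_ball.measurableSet] with y hy hy0 hy1
    have hY : 0 < ‖y‖ := norm_pos_iff.2 hy0
    have hb : conj (y ^ ((k : ℤ) - ell m n a)) ≠ 0 := (map_ne_zero _).2 (zpow_ne_zero _ hy0)
    have e : ∀ x, f (x, y) * conj (x ^ a * y ^ ((k : ℤ) - ell m n a)) =
        (f (x, y) * conj x ^ a) * conj (y ^ ((k : ℤ) - ell m n a)) := fun x => by
      rw [map_mul, map_pow, mul_assoc]
    simp only [e] at hy ⊢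
    have hy' : IntegrableOn (fun x => f (x, y) * conj x ^ a)
        (Metric.ball (0 : ℂ) (‖y‖ ^ ((m : ℝ) / n)⁻¹)) := by
      have := hy.mul_const (conj (y ^ ((k : ℤ) - ell m n a)))⁻¹
      refine this.congr (Filter.Eventually.of_forall fun x => ?_)
      simp only
      rw [mul_assoc, mul_inv_cancel₀ hb, mul_one]
    rw [integral_mul_const, setIntegral_slice_mul_conj_pow hγ hf.1 a hy0 hy1 hy',
      ← hfH y hy1 hy0]
    have e1 : conj (y ^ ((k : ℤ) - ell m n a)) = conj y ^ k * (conj y ^ ell m n a)⁻¹ := by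
      rw [map_zpow₀, zpow_sub₀ ((map_ne_zero _).2 hy0), zpow_natCast, zpow_natCast,
        div_eq_mul_inv]
    have e2 : (‖y‖ ^ ((m : ℝ) / n)⁻¹) ^ (2 * a + 2) = ‖y‖ ^ μ * ‖y‖ ^ (2 * ell m n a) := by
      rw [← Real.rpow_natCast, ← Real.rpow_mul hY.le, ← Real.rpow_natCast ‖y‖ (2 * _),
        ← Real.rpow_add hY, hμ, inv_div]
      congr 1
      push_cast
      ring
    have e3 : ((‖y‖ ^ (2 * ell m n a) : ℝ) : ℂ) = y ^ ell m n a * conj y ^ ell m n a := by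
      rw [← mul_pow, Complex.mul_conj', pow_mul]
      push_cast
      rfl
    have hcy : conj y ^ ell m n a ≠ 0 := pow_ne_zero _ ((map_ne_zero _).2 hy0)
    rw [e1, e2, Complex.ofReal_mul, Complex.ofReal_mul, e3]
    field_simp
  -- Inherited from Fubini: up to a constant this is the slice integral.
  have hbase : IntegrableOn (fun y => H y * conj y ^ k * (‖y‖ ^ μ : ℝ)) (Metric.ball 0 1) := by
    have h1 := (integrableOn_integral_slice hγ hint).congr hslice
    have h2 := h1.mul_const ((Real.pi / (a + 1) : ℝ) : ℂ)⁻¹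
    refine h2.congr (Filter.Eventually.of_forall fun y => ?_)
    have : ((Real.pi / (a + 1) : ℝ) : ℂ) ≠ 0 := Complex.ofReal_ne_zero.2 (by positivity)
    simp only
    rw [mul_assoc, mul_inv_cancel₀ this, mul_one]
  rw [setIntegral_hartogsTriangle hγ hint, integral_congr_ae hslice, integral_mul_const,
    setIntegral_ball_mul_conj_pow one_pos hH.continuousOn hsum k (by rw [hμe]; positivity) hbase,
    mul_assoc, ← Complex.ofReal_mul, hμe, Real.one_rpow]
  congr 2
  field_simp

/-- Integrating term by term, the weight (a+1)(`res` + mk) cancels the squared norm of the monomial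
up to π²m. Summing the surviving Laurent terms over k restores c_a(z₂). -/
theorem hasSum_integral_kerPart (hm : 0 < m) (hn : 0 < n) {f : ℂ × ℂ → ℂ}
    (hf : MemBergmanSpace (hartogsTriangle ((m : ℝ) / n)) f) {z : ℂ × ℂ}
    (hz : z ∈ hartogsTriangle ((m : ℝ) / n)) {j : ℕ} (hj : j < m) :
    HasSum (fun q => Real.pi ^ 2 * m * (taylorCoeff f (j + m * q) z.2 * z.1 ^ (j + m * q)))
      (∫ w in hartogsTriangle ((m : ℝ) / n),
        f w * conj (kerPart m n j (w.1 * conj z.1) (w.2 * conj z.2))) := by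
  have hγ : (0 : ℝ) < m / n := by positivity
  have hΩ := (isOpen_hartogsTriangle hγ).measurableSet
  have hm' : (0 : ℝ) < m := by positivity
  have hell : ∀ a : ℕ, ((m : ℝ) / n)⁻¹ * (a + 1) ≤ ell m n a := fun a => by
    rw [ell_eq hm, inv_div]
    have : (res m n a : ℝ) / m ≤ 1 := by
      rw [div_le_one hm']
      exact_mod_cast res_le hm n a
    linarith
  choose H hH hfH using fun a => exists_differentiableOn_pow_mul_taylorCoeff hf hγ a (hell a)
  set h : ℕ → ℕ → ℂ := fun a k => (k.factorial : ℂ)⁻¹ * iteratedDeriv k (H a) 0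
  have hsum : ∀ a, ∀ y ∈ Metric.ball (0 : ℂ) 1, HasSum (fun k => h a k * y ^ k) (H a y) := by
    intro a y hy
    have := Complex.hasSum_taylorSeries_on_ball (hH a) hy
    refine (congrArg (fun F => HasSum F _) (funext fun k => ?_)).mpr this
    simp only [h, sub_zero, smul_eq_mul]
    ring
  set G : ℕ × ℕ → ℂ × ℂ → ℂ := fun p w =>
    f w * conj (w.1 ^ (j + m * p.1) * w.2 ^ ((p.2 : ℤ) - ell m n (j + m * p.1))) *
      kerTerm m n z.1 z.2 (j + m * p.1) p.2 with hG
  have hz2 := snd_ne_zero_of_mem_hartogsTriangle hz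
  have hz2b : z.2 ∈ Metric.ball (0 : ℂ) 1 := by simpa using hz.2
  have hGi : ∀ p, Integrable (G p) (volume.restrict (hartogsTriangle ((m : ℝ) / n))) := fun p =>
    (integrableOn_mul_conj_monomial hm hn hf _ _).1.mul_const _
  -- The integral of |f| |w₂|^`domExp` does not depend on p, so summability at the point z suffices.
  have hGs : Summable fun p => ∫ w in hartogsTriangle ((m : ℝ) / n), ‖G p w‖ := by
    refine Summable.of_nonneg_of_le (fun p => integral_nonneg fun _ => norm_nonneg _) (fun p => ?_)
      ((summable_norm_kerTerm hm hn hz hj).mul_left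
        (∫ w in hartogsTriangle ((m : ℝ) / n), ‖f w‖ * ‖w.2‖ ^ domExp m n))
    simp only [hG, norm_mul _ (kerTerm _ _ _ _ _ _)]
    rw [integral_mul_const]
    exact mul_le_mul_of_nonneg_right (integrableOn_mul_conj_monomial hm hn hf _ _).2
      (norm_nonneg _)
  have key := hasSum_integral_of_summable_integral_norm hGi hGs
  have hval : ∀ p, ∫ w in hartogsTriangle ((m : ℝ) / n), G p w =
      Real.pi ^ 2 * m * (z.1 ^ (j + m * p.1) * (z.2 ^ ell m n (j + m * p.1))⁻¹) *
        (h (j + m * p.1) p.2 * z.2 ^ p.2) := by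
    intro p
    have hres : (res m n (j + m * p.1) + m * p.2 : ℂ) ≠ 0 := by
      have := res_pos m n (j + m * p.1)
      exact_mod_cast (by positivity : res m n (j + m * p.1) + m * p.2 ≠ 0)
    have ha : ((j + m * p.1 : ℕ) + 1 : ℂ) ≠ 0 := Nat.cast_add_one_ne_zero _
    simp only [hG]
    rw [integral_mul_const, setIntegral_mul_conj_monomial hm hn hf (hH _) (hfH _) (hsum _), kerTerm,
      zpow_sub₀ hz2, zpow_natCast, zpow_natCast]
    generalize j + m * p.1 = a at hres ha ⊢
    push_cast
    field_simp
  have htsum : ∫ w in hartogsTriangle ((m : ℝ) / n), ∑' p, G p w =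
      ∫ w in hartogsTriangle ((m : ℝ) / n),
        f w * conj (kerPart m n j (w.1 * conj z.1) (w.2 * conj z.2)) := by
    refine setIntegral_congr_fun hΩ fun w hw => ?_
    have h1 := (hasSum_kerPart hm hn hz hw hj).mul_left (f w)
    have h2 : conj (kerPart m n j (w.1 * conj z.1) (w.2 * conj z.2)) =
        kerPart m n j (z.1 * conj w.1) (z.2 * conj w.2) := by
      rw [conj_kerPart, map_mul, map_mul, Complex.conj_conj, Complex.conj_conj, mul_comm z.1,
        mul_comm z.2]
    rw [h2, ← h1.tsum_eq]
    refine tsum_congr fun p => ?_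
    rw [kerTerm_mul_conj, hG]
    ring
  rw [htsum] at key
  simp only [hval] at key
  refine key.prod_fiberwise fun q => ?_
  have h3 := (hsum (j + m * q) z.2 hz2b).mul_left
    (Real.pi ^ 2 * m * (z.1 ^ (j + m * q) * (z.2 ^ ell m n (j + m * q))⁻¹) : ℂ)
  rw [← hfH _ _ hz2b hz2] at h3
  convert! h3 using 1
  have := pow_ne_zero (ell m n (j + m * q)) hz2
  field_simp

/-- The closed form of the Bergman kernel. -/
def kernel (m n : ℕ) (z w : ℂ × ℂ) : ℂ :=
  (m * (Real.pi : ℂ) ^ 2)⁻¹ *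
    ∑ j ∈ Finset.range m, kerPart m n j (z.1 * conj w.1) (z.2 * conj w.2)

/-- The m residue classes together exhaust the Taylor series of f in z₁, so their integrals add up
to π²m f(z). -/
theorem isBergmanKernel_kernel (hm : 0 < m) (hn : 0 < n) :
    IsBergmanKernel (hartogsTriangle ((m : ℝ) / n)) (kernel m n) where
  mem w hw := by
    have hk := fun j (hj : j ∈ Finset.range m) =>
      memBergmanSpace_kerPart hm hn hw (Finset.mem_range.1 hj)
    exact ⟨(DifferentiableOn.fun_sum fun j hj => (hk j hj).1).const_mul _,
      (memLp_finsetSum _ fun j hj => (hk j hj).2).const_mul _⟩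
  reproducing f hf z hz := by
    have hγ : (0 : ℝ) < m / n := by positivity
    have hsum := ((hasSum_taylorCoeff hγ hf.1 (x := z.1) (y := z.2) hz).mul_left
      (Real.pi ^ 2 * m : ℂ)).sum_residueClasses hm
      (I := fun j => ∫ w in hartogsTriangle ((m : ℝ) / n),
        f w * conj (kerPart m n j (w.1 * conj z.1) (w.2 * conj z.2)))
      (fun j hj => hasSum_integral_kerPart hm hn hf hz hj)
    have hi : ∀ j ∈ Finset.range m, Integrable (fun w =>
        f w * conj (kerPart m n j (w.1 * conj z.1) (w.2 * conj z.2)))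
        (volume.restrict (hartogsTriangle ((m : ℝ) / n))) := fun j hj =>
      hf.2.integrable_mul (memBergmanSpace_kerPart hm hn hz (Finset.mem_range.1 hj)).2.star
    rw [← integral_finsetSum _ hi] at hsum
    have hc : (m * (Real.pi : ℂ) ^ 2) ≠ 0 :=
      mul_ne_zero (by exact_mod_cast hm.ne')
        (pow_ne_zero _ (Complex.ofReal_ne_zero.2 Real.pi_ne_zero))
    have e : ∀ w, f w * conj (kernel m n w z) = (m * (Real.pi : ℂ) ^ 2)⁻¹ *
        ∑ j ∈ Finset.range m,
          f w * conj (kerPart m n j (w.1 * conj z.1) (w.2 * conj z.2)) := fun w => by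
      rw [kernel, ← Finset.mul_sum]
      simp only [map_mul, map_sum, map_inv₀, map_pow, map_natCast, Complex.conj_ofReal]
      ring
    simp_rw [e]
    rw [integral_const_mul, hsum, mul_comm (Real.pi ^ 2 : ℂ), inv_mul_cancel_left₀ hc]

end Domain

end HartogsKernel

end

/-- The Bergman kernel of the rational Hartogs triangle of exponent `m / n > 1`. -/
theorem theorem1p1 (m n : ℕ) (hn : 0 < n) (hmn : n < m) (hcop : Nat.Coprime m n) :
    (∃ K : ℂ × ℂ → ℂ × ℂ → ℂ, IsBergmanKernel (hartogsTriangle ((m : ℝ) / n)) K ∧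
      ∀ z ∈ hartogsTriangle ((m : ℝ) / n), ∀ w ∈ hartogsTriangle ((m : ℝ) / n),
        ∀ s t : ℂ, s = z.1 * (starRingEnd ℂ) w.1 → t = z.2 * (starRingEnd ℂ) w.2 →
          (1 - t) ^ 2 * (t ^ n - s ^ m) ^ 2 ≠ 0 ∧
          K z w = MvPolynomial.aeval ![s, t] (HartogsKernel.P m n) /
            (m * (Real.pi : ℂ) ^ 2 * (1 - t) ^ 2 * (t ^ n - s ^ m) ^ 2)) ∧
    (HartogsKernel.P m n).totalDegree = 2 * m - 1 ∧
    (HartogsKernel.P m n).support.card = 4 * m - 3 := by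
  have hm : 0 < m := by omega
  refine ⟨⟨HartogsKernel.kernel m n, HartogsKernel.isBergmanKernel_kernel hm hn, ?_⟩,
    HartogsKernel.totalDegree_P hn hmn hcop, HartogsKernel.card_support_P hm hcop⟩
  rintro z hz w hw s t rfl rfl
  refine ⟨HartogsKernel.denominator_ne_zero (HartogsKernel.norm_mul_conj_snd_lt hz hw)
    (HartogsKernel.norm_mul_conj_pow_lt hn hz hw), ?_⟩
  rw [HartogsKernel.aeval_P_div hm hcop]
  rfl
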